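/- Let $\mathscr A$ be a unital $C^*$-algebra with a pointwise norm-continuous action $\alpha$ of $\mathbb R^n$ by $*$-automorphisms, let $B$ be a skew-symmetric real $n\times n$ matrix, and let $\psi$ be an $\alpha$-invariant continuous trace on $\mathscr A$. Let $\mathscr A^\infty$ be the Fréchet space of all $a\in\mathscr A$ for which $t\mapsto\alpha_t(a)$ is smooth, with semi-norms $\|\delta^\gamma a\|$, $\delta^\gamma a=i^{-|\gamma|}\partial_t^\gamma|_{t=0}\alpha_t(a)$. Write $\langle\xi\rangle=(1+|\xi|^2)^{1/2}$. For $m\in\mathbb R$, $\mathrm S^m(\mathbb R^n,\mathscr A^\infty)$ is the space of smooth $f:\mathbb R^n\to\mathscr A^\infty$ with $\|\delta^\gamma\partial_\xi^\beta f(\xi)\|\le C_{\gamma\beta}\langle\xi\rangle^{m-|\beta|}$ for all $\gamma,\beta$. For $f\in \mathrm S^m(\mathbb R^n,\mathscr A^\infty)$ the multiplier $P_f$ acts on $u\in\mathscr S(\mathbb R^n,\mathscr A^\infty)$ by $$(P_fu)(x)=(2\pi)^{-n}\int_{\mathbb R^n} e^{i\langle x,\xi\rangle}\alpha_{-x}(f(\xi+Bx))\,\hat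 u(\xi)\,d\xi ,\qquad \hat u(\xi)=\int_{\mathbb R^n} e^{-i\langle x,\xi\rangle}u(x)\,dx,$$ and, if $m<-n$, $\mathrm{Tr}_\psi(P_f):=\psi(f^\vee(0))=(2\pi)^{-n}\int_{\mathbb R^n}\psi(f(\xi))\,d\xi$, where $f^\vee$ is the inverse Fourier transform of $f$. Let $\Gamma=\{re^{i\theta}:r>0,\ \theta_1<\theta<\theta_2\}$ with $0<\theta_2-\theta_1\le 2\pi$ be an open sector, and let $\log\mu=\log r+i\theta$ and $\mu^s=e^{s\log\mu}$ ($s\in\mathbb R$) be formed with $\theta\in(\theta_1,\theta_2)$. For $m,d\in\mathbb R$, $\mathrm S^{m,d}(\mathbb R^n\times\Gamma,\mathscr A^\infty)$ is the space of smooth $f:\mathbb R^n\times\Gamma\to\mathscr A^\infty$, holomorphic in $\mu\in\Gamma$, such that for all $j\ge0$ and $1/z\in\Gamma$ one has $\partial_z^j(z^df(\cdot,1/z))\in \mathrm S^{m+j}(\mathbb R^n,\mathscr A^\infty)$, with uniform symbol estimates for $|z|\le1$ and $1/z$ in any closed subsector of $\Gamma$ (here $z^d=(1/z)^{-d}$).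 Let $m,d\in\mathbb R$ and let $f\in \mathrm S^{m-d,d}(\mathbb R^n\times\Gamma,\mathscr A^\infty)$ be weakly polyhomogeneous, $f\sim\sum_{j\ge0}f_{m-j}$; that is, $f_{m-j}\in \mathrm S^{m-j-d,d}(\mathbb R^n\times\Gamma,\mathscr A^\infty)$, $f_{m-j}(t\xi,t\mu)=t^{m-j}f_{m-j}(\xi,\mu)$ for $|\xi|\ge1$, $\mu\in\Gamma$, $t\ge1$, and $f-\sum_{j<N}f_{m-j}\in \mathrm S^{m-d-N,d}(\mathbb R^n\times\Gamma,\mathscr A^\infty)$ for all $N\ge 0$. Assume that there are $m'<-n$ and $d'\in\mathbb R$ such that $f$ and all $f_{m-j}$ with $m-j-d\ge-n$ lie in $\mathrm S^{m',d'}(\mathbb R^n\times\Gamma,\mathscr A^\infty)$. Then for every $\mu\in\Gamma$ the symbol $f(\cdot,\mu)$ has order $<-n$, so that $\mathrm{Tr}_\psi(P_{f(\cdot,\mu)})=(2\pi)^{-n}\int\psi(f(\xi,\mu))\,d\xi$ is defined with a convergent integral, and there are complex numbers $c_j,c_k',c_k''$ $(j,k\ge0)$ such that $$\mathrm{Tr}_\psi(P_{f(\cdot,\mu)})\sim\sum_{j=0}^\infty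 c_j\mu^{m-j+n}+\sum_{k=0}^\infty(c_k'\log\mu+c_k'')\mu^{-k+d}$$ as $\mu\to\infty$ in closed subsectors of $\Gamma$; that is, for every closed subsector $\Gamma'$ of $\Gamma$ and all $J,K\ge0$ there is $C$ such that, for all $\mu\in\Gamma'$ with $|\mu|\ge1$, $$\Big|\mathrm{Tr}_\psi(P_{f(\cdot,\mu)})-\sum_{j<J}c_j\mu^{m-j+n}-\sum_{k<K}(c_k'\log\mu+c_k'')\mu^{-k+d}\Big|\le C\big(|\mu|^{m-J+n}+(1+\log|\mu|)|\mu|^{d-K}\big).$$ -/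

import Mathlib

open scoped ContDiff InnerProductSpace

noncomputable section

namespace WeaklyParametric

/-- Euclidean space `ℝⁿ`. -/
abbrev E (n : ℕ) : Type := EuclideanSpace ℝ (Fin n)

/-- The length `|γ|` of a multi-index. -/
def mlen {n : ℕ} (γ : Fin n → ℕ) : ℕ := ∑ i, γ i

/-- The iterated partial derivative `∂^γ g (x)`: the derivative of order `|γ|` of `g`, evaluated on
the list of basis vectors in which `e_i` occurs `γ i` times. -/
def pderiv {n : ℕ} {F : Type*} [NormedAddCommGroup F] [NormedSpace ℝ F]
    (γ : Fin n → ℕ) (g : E n → F) (x : E n) : F :=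
  iteratedFDeriv ℝ (∑ i, γ i) g x
    (fun k => EuclideanSpace.single (finSigmaFinEquiv.symm k).1 (1 : ℝ))

/-- The Japanese bracket `⟨ξ⟩ = (1 + |ξ|²)^{1/2}`. -/
def jb {n : ℕ} (ξ : E n) : ℝ := Real.sqrt (1 + ‖ξ‖ ^ 2)

/-! ### Twisted `C*`-dynamical systems -/

/-- A twisted `C*`-dynamical system `(A, ℝⁿ, α, e)`: a pointwise norm-continuous action `α` of `ℝⁿ`
on the unital `C*`-algebra `A` by `*`-automorphisms, and the cocycle `e(x,y) = exp(i⟨Bx, y⟩)`,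
recorded through the skew-symmetric real matrix `B`. -/
structure TwistedSystem (n : ℕ) (A : Type*) [CStarAlgebra A] where
  act : E n → (A ≃⋆ₐ[ℂ] A)
  act_zero : ∀ a, act 0 a = a
  act_add : ∀ s t a, act (s + t) a = act s (act t a)
  act_continuous : ∀ a, Continuous fun t => act t a
  B : Matrix (Fin n) (Fin n) ℝ
  skew : B.transpose = -B

namespace TwistedSystem

variable {n : ℕ} {A : Type*} [CStarAlgebra A] (S : TwistedSystem n A)

/-- Membership in the smooth subalgebra `A^∞`. -/
def IsSmooth (a : A) : Prop := ContDiff ℝ ∞ fun t => S.act t a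

/-- `δ^γ a = i^{-|γ|} ∂_t^γ|_{t=0} α_t(a)`. -/
def delta (γ : Fin n → ℕ) (a : A) : A :=
  (Complex.I⁻¹ ^ mlen γ) • pderiv γ (fun t => S.act t a) 0

/-- Smoothness on an open set `U` of a map with values in the Fréchet space `A^∞`. The maps `δ^γ`
embed `A^∞` as a closed subspace of the product of copies of `A` indexed by `γ`, so a map into
`A^∞` is smooth exactly if all its components `δ^γ ∘ g` are. -/
def SmoothOn {V : Type*} [NormedAddCommGroup V] [NormedSpace ℝ V] (g : V → A) (U : Set V) : Prop :=
  (∀ x ∈ U, S.IsSmooth (g x)) ∧ ∀ γ : Fin n → ℕ, ContDiffOn ℝ ∞ (fun x => S.delta γ (g x)) U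

/-- The symbol space `S^m(ℝⁿ, A^∞)`. -/
def IsSymbol (m : ℝ) (f : E n → A) : Prop :=
  S.SmoothOn f Set.univ ∧
    ∀ a b : Fin n → ℕ, ∃ C : ℝ, ∀ ξ : E n, ‖S.delta a (pderiv b f ξ)‖ ≤ C * jb ξ ^ (m - mlen b)

/-! ### Pseudodifferential multipliers and the trace -/

/-- The Schwartz space `𝒮(ℝⁿ, A^∞)`: all the maps `δ^γ ∘ u` are `A`-valued Schwartz maps. -/
def SchwartzSmooth : Type _ :=
  {u : SchwartzMap (E n) A // (∀ x, S.IsSmooth (u x)) ∧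
    ∀ γ : Fin n → ℕ, ∃ v : SchwartzMap (E n) A, ∀ x, v x = S.delta γ (u x)}

/-- The Fourier transform `û(ξ) = ∫ e^{-i⟨x,ξ⟩} u(x) dx`. -/
def fourier (u : E n → A) (ξ : E n) : A :=
  ∫ x : E n, Complex.exp (-(Complex.I * (⟪x, ξ⟫_ℝ : ℝ))) • u x

/-- The inverse Fourier transform `g^∨(x) = (2π)^{-n} ∫ e^{i⟨ξ,x⟩} g(ξ) dξ`. -/
def invFourier (g : E n → A) (x : E n) : A :=
  ((2 * Real.pi : ℝ) ^ n)⁻¹ • ∫ ξ : E n, Complex.exp (Complex.I * (⟪ξ, x⟫_ℝ : ℝ)) • g ξ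

/-- The vector `Bx`. -/
def applyB (x : E n) : E n := WithLp.toLp 2 (S.B.mulVec x.ofLp)

/-- The pseudodifferential multiplier `P_f = M_{f^∨}` on `𝒮(ℝⁿ, A^∞)`:
`(P_f u)(x) = (2π)^{-n} ∫ e^{i⟨x,ξ⟩} α_{-x}(f(ξ + Bx)) û(ξ) dξ`. -/
def multiplier (f : E n → A) (u : S.SchwartzSmooth) (x : E n) : A :=
  ((2 * Real.pi : ℝ) ^ n)⁻¹ •
    ∫ ξ : E n, Complex.exp (Complex.I * (⟪x, ξ⟫_ℝ : ℝ)) •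
      (S.act (-x) (f (ξ + S.applyB x)) * fourier u.1 ξ)

/-- `P` is a pseudodifferential multiplier `P_f` with symbol `f` of order `< -n`. -/
def HasTraceSymbol (P : S.SchwartzSmooth → E n → A) (f : E n → A) : Prop :=
  (∃ m : ℝ, m < -(n : ℝ) ∧ S.IsSymbol m f) ∧ S.multiplier f = P

open Classical in
/-- The trace `Tr_ψ(P_f) = ψ(f^∨(0))` on the pseudodifferential multipliers of order `< -n`
(and `0` on all other operators). The symbol is determined by the operator. -/
def Tr (ψ : A →L[ℂ] ℂ) (P : S.SchwartzSmooth → E n → A) : ℂ :=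
  if h : ∃ f, S.HasTraceSymbol P f then ψ (invFourier h.choose 0) else 0

end TwistedSystem

/-- `ψ` is an `α`-invariant continuous trace. -/
def IsInvariantTrace {n : ℕ} {A : Type*} [CStarAlgebra A] (S : TwistedSystem n A)
    (ψ : A →L[ℂ] ℂ) : Prop :=
  (∀ a b, ψ (a * b) = ψ (b * a)) ∧ ∀ t a, ψ (S.act t a) = ψ a

/-! ### Sectors -/

/-- An open sector `{r e^{iθ} : r > 0, lo < θ < hi}` in `ℂ ∖ {0}`. -/
structure Sector where
  lo : ℝ
  hi : ℝ
  lo_lt_hi : lo < hi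
  width_le : hi - lo ≤ 2 * Real.pi

namespace Sector

/-- The open sector as a set. -/
def carrier (Γ : Sector) : Set ℂ :=
  {μ | ∃ r > 0, ∃ θ ∈ Set.Ioo Γ.lo Γ.hi, μ = (r : ℝ) * Complex.exp ((θ : ℝ) * Complex.I)}

/-- The closed sector `{r e^{iθ} : r > 0, a ≤ θ ≤ b}`; it is a closed subsector of `Γ` if
`Γ.lo < a` and `b < Γ.hi`. -/
def closedSector (a b : ℝ) : Set ℂ :=
  {μ | ∃ r > 0, ∃ θ ∈ Set.Icc a b, μ = (r : ℝ) * Complex.exp ((θ : ℝ) * Complex.I)}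

/-- The branch of the logarithm on `Γ` with imaginary part in `(lo, hi)`. -/
def log (Γ : Sector) (μ : ℂ) : ℂ :=
  Complex.log (μ * Complex.exp (-(((Γ.lo + Γ.hi) / 2 : ℝ) * Complex.I))) +
    ((Γ.lo + Γ.hi) / 2 : ℝ) * Complex.I

/-- The power `μ^s`, for real `s`, formed with the branch `Γ.log`. -/
def pow (Γ : Sector) (μ : ℂ) (s : ℝ) : ℂ := Complex.exp (s * Γ.log μ)

theorem log_polar (Γ : Sector) {r θ : ℝ} (hr : 0 < r) (hθ : θ ∈ Set.Ioo Γ.lo Γ.hi) :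
    Γ.log (r * Complex.exp (θ * Complex.I)) = Real.log r + θ * Complex.I := by
  have hw := Γ.width_le
  obtain ⟨h1, h2⟩ := hθ
  have h : (r * Complex.exp (θ * Complex.I)) *
      Complex.exp (-(((Γ.lo + Γ.hi) / 2 : ℝ) * Complex.I)) =
      Complex.exp ((Real.log r : ℝ) + ((θ - (Γ.lo + Γ.hi) / 2 : ℝ) : ℂ) * Complex.I) := by
    rw [Complex.exp_add, ← Complex.ofReal_exp, Real.exp_log hr, mul_assoc, ← Complex.exp_add]
    push_cast
    ring_nf
  unfold Sector.log
  rw [h, Complex.log_exp]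
  · push_cast
    ring
  · simp
    linarith
  · simp
    linarith

end Sector

/-! ### Weakly parametric symbols -/

variable {n : ℕ} {A : Type*} [CStarAlgebra A]

/-- `∂_z^j (z^d f(ξ, 1/z))`, the power being `z^d = (1/z)^{-d}` for the branch on `Γ ∋ 1/z`. -/
def zDeriv (Γ : Sector) (d : ℝ) (f : E n → ℂ → A) (j : ℕ) (z : ℂ) (ξ : E n) : A :=
  iteratedDeriv j (fun w : ℂ => Γ.pow w⁻¹ (-d) • f ξ w⁻¹) z

/-- The space `S^{m,d}(ℝⁿ × Γ, A^∞)` of weakly parametric symbols. -/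
structure IsWeakSymbol (S : TwistedSystem n A) (Γ : Sector) (m d : ℝ) (f : E n → ℂ → A) :
    Prop where
  smooth : S.SmoothOn (fun p : E n × ℂ => f p.1 p.2) (Set.univ ×ˢ Γ.carrier)
  /-- holomorphic in `μ`, as a map into `A^∞` -/
  holomorphic : ∀ (ξ : E n) (γ : Fin n → ℕ),
    DifferentiableOn ℂ (fun μ => S.delta γ (f ξ μ)) Γ.carrier
  symbol : ∀ (j : ℕ) (z : ℂ), z⁻¹ ∈ Γ.carrier → S.IsSymbol (m + j) (zDeriv Γ d f j z)
  uniform : ∀ (j : ℕ) (a b : ℝ), Γ.lo < a → b < Γ.hi → ∀ γ β : Fin n → ℕ, ∃ C : ℝ,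
    ∀ (z : ℂ), z⁻¹ ∈ Sector.closedSector a b → ‖z‖ ≤ 1 → ∀ ξ : E n,
      ‖S.delta γ (pderiv β (zDeriv Γ d f j z) ξ)‖ ≤ C * jb ξ ^ (m + j - mlen β)

/-- `f ∈ S^{∞,d}` is weakly polyhomogeneous with expansion `f ∼ ∑_j F j`, where `F j = f_{m-j}`. -/
structure IsWeaklyPolyhomogeneous (S : TwistedSystem n A) (Γ : Sector) (m d : ℝ)
    (f : E n → ℂ → A) (F : ℕ → E n → ℂ → A) : Prop where
  mem : IsWeakSymbol S Γ (m - d) d f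
  term_mem : ∀ j : ℕ, IsWeakSymbol S Γ (m - j - d) d (F j)
  homogeneous : ∀ (j : ℕ) (ξ : E n) (μ : ℂ) (t : ℝ), 1 ≤ ‖ξ‖ → μ ∈ Γ.carrier → 1 ≤ t →
    F j (t • ξ) (t * μ) = (t ^ (m - j) : ℝ) • F j ξ μ
  remainder : ∀ N : ℕ,
    IsWeakSymbol S Γ (m - d - N) d (fun ξ μ => f ξ μ - ∑ j ∈ Finset.range N, F j ξ μ)

/-- The asymptotic expansion
`G(μ) ∼ ∑_j c_j μ^{p-j} + ∑_k (c'_k log μ + c''_k) μ^{d-k}` as `μ → ∞`, uniformly in closed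
subsectors of `Γ`: every truncation has an error of the order of the first omitted terms. -/
def HasLogExpansion (Γ : Sector) (p d : ℝ) (G : ℂ → ℂ) (c c' c'' : ℕ → ℂ) : Prop :=
  ∀ a b : ℝ, Γ.lo < a → b < Γ.hi → ∀ J K : ℕ, ∃ C : ℝ,
    ∀ μ ∈ Sector.closedSector a b, 1 ≤ ‖μ‖ →
      ‖G μ - ∑ j ∈ Finset.range J, c j * Γ.pow μ (p - j)
          - ∑ k ∈ Finset.range K, (c' k * Γ.log μ + c'' k) * Γ.pow μ (d - k)‖
        ≤ C * (‖μ‖ ^ (p - J) + (1 + Real.log ‖μ‖) * ‖μ‖ ^ (d - K))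

end WeaklyParametric

end

noncomputable section

namespace WeaklyParametric

open MeasureTheory Filter Topology

/-! ### Symbol estimates, integrability, and recovery of a symbol from its multiplier. -/

section

variable {n : ℕ} {A : Type*} [CStarAlgebra A]

/-! Put `μ = e^w`. The sector becomes a strip, `log μ` becomes `w`, and `z = 1/μ = e^{-w}`. Since
the `z`-derivatives of `z^d f` are bounded by powers of `⟨ξ⟩`, there is a Taylor expansion at `z =
0` with coefficients `τ_k(ξ) = O(⟨ξ⟩^{M+k})`, where `M` is the order of the symbol
(`IsParamSymbol.exists_taylor`). Each Taylor term costs one order of decay in `ξ`, so only symbols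
of very low order can be expanded under the integral over `ℝⁿ`. This settles the remainder `f -
∑_{j<N} f_{m-j}` for large `N` and gives powers `μ^{d-k}` without logarithms.

For a term `F` homogeneous of degree `q`, the integral over the unit ball is expanded in the same
way. Outside the ball, polar coordinates with radius `e^t` and homogeneity turn the integral into
`e^{pw}`, `p = q + n`, times the sphere average of `∫_{-∞}^{Re w} e^{-p(s+iθ)} F(η, e^{s+iθ}) ds`
with `θ = Im w`. Convergence at `-∞` comes from membership in `S^{m',d'}` with `m' < -n`. Near `+∞`
the integrand is `∑ e^{(d-k-p)w} τ_k(η)` up to a small error, and termwise primitives give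
`μ^{d-k}`, with a factor `log μ` exactly when `d - k = p`. The constant of integration gives the
global term `c μ^{q+n}`; by Cauchy's theorem it is the same on every ray
(`HomogeneousOutside.integral_expansion`).

Summing over `j` gives an expansion to each finite order. Uniqueness of such expansions makes the
coefficients compatible (`exists_coefficients`). All this is done for the `A`-valued integral; the
functional `ψ` is applied last. That `Tr` sees the given symbol at all is `HasTraceSymbol.eq`. -/

theorem one_le_jb (ξ : E n) : 1 ≤ jb ξ := by
  rw [jb, Real.one_le_sqrt]
  nlinarith [sq_nonneg ‖ξ‖]

theorem jb_pos (ξ : E n) : 0 < jb ξ := zero_lt_one.trans_le (one_le_jb ξ)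

theorem norm_le_jb (ξ : E n) : ‖ξ‖ ≤ jb ξ :=
  Real.le_sqrt_of_sq_le (by linarith)

theorem continuous_jb : Continuous (jb : E n → ℝ) := by
  unfold jb
  fun_prop

theorem continuous_jb_rpow (s : ℝ) : Continuous fun ξ : E n => jb ξ ^ s :=
  continuous_jb.rpow_const fun ξ => Or.inl (jb_pos ξ).ne'

theorem integrable_jb_rpow {s : ℝ} (hs : s < -(n : ℝ)) : Integrable fun ξ : E n => jb ξ ^ s := by
  have h := integrable_rpow_neg_one_add_norm_sq (E := E n) (μ := volume) (r := -s)
    (by simp; linarith)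
  refine h.congr (Eventually.of_forall fun ξ => ?_)
  simp only [jb, neg_neg]
  rw [← Real.rpow_div_two_eq_sqrt _ (by positivity)]

theorem iteratedFDeriv_of_eq_zero {F : Type*} [NormedAddCommGroup F] [NormedSpace ℝ F]
    {k : ℕ} (hk : k = 0) (g : E n → F) (x : E n) (v : Fin k → E n) :
    iteratedFDeriv ℝ k g x v = g x := by
  subst hk
  simp

theorem pderiv_zero {F : Type*} [NormedAddCommGroup F] [NormedSpace ℝ F]
    (g : E n → F) (x : E n) : pderiv 0 g x = g x :=
  iteratedFDeriv_of_eq_zero (by simp) g x _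

theorem mlen_zero : mlen (0 : Fin n → ℕ) = 0 := by simp [mlen]

/-- For `c ≠ 0` scaling is a linear isomorphism, so no differentiability of `g` is required. -/
theorem pderiv_const_smul {c : ℂ} (hc : c ≠ 0) (γ : Fin n → ℕ) (g : E n → A) (x : E n) :
    pderiv γ (fun y => c • g y) x = c • pderiv γ g x := by
  have h := (ContinuousLinearEquiv.smulLeft (R₁ := ℝ) (M₁ := A)
    (Units.mk0 c hc)).iteratedFDeriv_comp_left (f := g) (x := x) (i := ∑ i, γ i)
  exact congrArg (fun T => T fun k => EuclideanSpace.single (finSigmaFinEquiv.symm k).1 (1 : ℝ)) h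

namespace TwistedSystem

variable (S : TwistedSystem n A)

theorem delta_zero (a : A) : S.delta 0 a = a := by
  rw [delta, pderiv_zero, mlen_zero, S.act_zero, pow_zero, one_smul]

theorem delta_const_smul {c : ℂ} (hc : c ≠ 0) (γ : Fin n → ℕ) (a : A) :
    S.delta γ (c • a) = c • S.delta γ a := by
  simp only [delta, map_smul]
  rw [pderiv_const_smul hc, smul_comm]

variable {S}

theorem IsSymbol.continuous {m : ℝ} {f : E n → A} (hf : S.IsSymbol m f) : Continuous f := by
  have h := (hf.1.2 0).continuousOn
  simp only [delta_zero] at h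
  exact continuousOn_univ.1 h

theorem IsSymbol.exists_norm_le {m : ℝ} {f : E n → A} (hf : S.IsSymbol m f) :
    ∃ C, ∀ ξ, ‖f ξ‖ ≤ C * jb ξ ^ m := by
  obtain ⟨C, hC⟩ := hf.2 0 0
  refine ⟨C, fun ξ => ?_⟩
  simpa [delta_zero, pderiv_zero, mlen_zero] using hC ξ

theorem IsSymbol.integrable {m : ℝ} {f : E n → A} (hf : S.IsSymbol m f) (hm : m < -(n : ℝ)) :
    Integrable f := by
  obtain ⟨C, hC⟩ := hf.exists_norm_le
  exact ((integrable_jb_rpow hm).const_mul C).mono' hf.continuous.aestronglyMeasurable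
    (Eventually.of_forall hC)

theorem IsSymbol.const_smul {m : ℝ} {f : E n → A} (hf : S.IsSymbol m f) {c : ℂ} (hc : c ≠ 0) :
    S.IsSymbol m (fun ξ => c • f ξ) := by
  refine ⟨⟨fun x hx => ?_, fun γ => ?_⟩, fun a b => ?_⟩
  · have := hf.1.1 x hx
    unfold IsSmooth at this ⊢
    simp only [map_smul]
    exact ContDiff.const_smul c this
  · simp only [S.delta_const_smul hc]
    exact ContDiffOn.const_smul c (hf.1.2 γ)
  · obtain ⟨C, hC⟩ := hf.2 a b
    refine ⟨‖c‖ * C, fun ξ => ?_⟩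
    rw [pderiv_const_smul hc, S.delta_const_smul hc, norm_smul, mul_assoc]
    exact mul_le_mul_of_nonneg_left (hC ξ) (norm_nonneg c)

/-! ### The symbol is determined by the multiplier -/

/-- The Schwartz map `φ • 1`. -/
def scalarSchwartz (S : TwistedSystem n A) (φ : SchwartzMap (E n) ℂ) : S.SchwartzSmooth :=
  ⟨φ.postcompCLM ((ContinuousLinearMap.id ℂ ℂ).smulRight (1 : A)), by
    constructor
    · intro x
      simp only [IsSmooth, SchwartzMap.postcompCLM_apply, ContinuousLinearMap.smulRight_apply,
        map_smul, map_one]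
      exact contDiff_const
    · intro γ
      refine ⟨φ.postcompCLM ((ContinuousLinearMap.id ℂ ℂ).smulRight (S.delta γ 1)), fun x => ?_⟩
      simp only [SchwartzMap.postcompCLM_apply, ContinuousLinearMap.smulRight_apply,
        ContinuousLinearMap.id_apply]
      by_cases h : φ x = 0
      · have : S.delta γ 0 = 0 := by
          have := S.delta_const_smul (c := 2) two_ne_zero γ 0
          rw [smul_zero, two_smul] at this
          simpa using this
        simp [h, this]
      · rw [S.delta_const_smul h]⟩

theorem fourier_scalarSchwartz (φ : SchwartzMap (E n) ℂ) (ξ : E n) :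
    fourier (S.scalarSchwartz φ).1 ξ =
      (FourierTransform.fourier φ : SchwartzMap (E n) ℂ) ((2 * Real.pi)⁻¹ • ξ) • (1 : A) := by
  rw [SchwartzMap.fourier_coe, Real.fourier_eq', ← integral_smul_const, fourier]
  refine integral_congr_ae (Eventually.of_forall fun x => ?_)
  simp only [scalarSchwartz, SchwartzMap.postcompCLM_apply, ContinuousLinearMap.smulRight_apply,
        ContinuousLinearMap.id_apply, smul_smul, inner_smul_right, smul_eq_mul]
  congr 3
  have := Real.pi_ne_zero
  push_cast
  field_simp

/-- The function is the inverse Fourier transform of `h`, dilated by `2π` to pass between the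
kernels `e^{-2πi⟨x,ξ⟩}` and `e^{-i⟨x,ξ⟩}`. -/
theorem exists_fourier_eq (S : TwistedSystem n A) {h : E n → ℝ} (h1 : ContDiff ℝ ∞ h)
    (h2 : HasCompactSupport h) :
    ∃ u : S.SchwartzSmooth, ∀ ξ, fourier u.1 ξ = ((h ξ : ℝ) : ℂ) • (1 : A) := by
  have h3 : HasCompactSupport fun ξ => ((h ξ : ℝ) : ℂ) := h2.comp_left (g := Complex.ofReal) rfl
  have h4 : ContDiff ℝ ∞ fun ξ => ((h ξ : ℝ) : ℂ) := Complex.ofRealCLM.contDiff.comp h1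
  have hpi : (2 * Real.pi) ≠ 0 := by positivity
  let g : SchwartzMap (E n) ℂ := SchwartzMap.compCLMOfContinuousLinearEquiv ℂ
    (ContinuousLinearEquiv.smulLeft (R₁ := ℝ) (M₁ := E n) (Units.mk0 (2 * Real.pi) hpi))
    (h3.toSchwartzMap h4)
  refine ⟨S.scalarSchwartz (FourierTransformInv.fourierInv g), fun ξ => ?_⟩
  rw [fourier_scalarSchwartz, FourierTransform.fourier_fourierInv_eq]
  congr 1
  change ((h ((2 * Real.pi) • (2 * Real.pi)⁻¹ • ξ) : ℝ) : ℂ) = h ξ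
  rw [smul_smul, mul_inv_cancel₀ hpi, one_smul]

/-- At `x = 0` the action, the twist by `B` and the exponential all disappear, leaving a pairing of
the symbol with `û`. -/
theorem multiplier_apply_zero (f : E n → A) (u : S.SchwartzSmooth) :
    S.multiplier f u 0 = ((2 * Real.pi : ℝ) ^ n)⁻¹ • ∫ ξ : E n, f ξ * fourier u.1 ξ := by
  have : S.applyB 0 = 0 := by simp [applyB]
  simp [multiplier, this, S.act_zero]

/-- Evaluating at `0` on functions whose transform is a scalar bump recovers the integrals of the
symbol against all test functions. These determine it almost everywhere, hence everywhere by
continuity. -/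
theorem HasTraceSymbol.eq {P : S.SchwartzSmooth → E n → A} {f g : E n → A}
    (hf : S.HasTraceSymbol P f) (hg : S.HasTraceSymbol P g) : f = g := by
  obtain ⟨⟨m, hm, hfm⟩, hfP⟩ := hf
  obtain ⟨⟨m', hm', hgm⟩, hgP⟩ := hg
  have hae : ∀ᵐ ξ, f ξ = g ξ := by
    refine ae_eq_of_integral_contDiff_smul_eq (hfm.integrable hm).locallyIntegrable
      (hgm.integrable hm').locallyIntegrable fun h h1 h2 => ?_
    obtain ⟨u, hu⟩ := S.exists_fourier_eq h1 h2
    have := congrFun (congrFun (hfP.trans hgP.symm) u) 0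
    rw [multiplier_apply_zero, multiplier_apply_zero] at this
    have := smul_right_injective A (r := ((2 * Real.pi : ℝ) ^ n)⁻¹) (by positivity) this
    simpa [hu] using this
  exact hfm.continuous.ae_eq_iff_eq volume hgm.continuous |>.1 hae

theorem HasTraceSymbol.tr_eq {f : E n → A} (ψ : A →L[ℂ] ℂ)
    (hf : S.HasTraceSymbol (S.multiplier f) f) :
    S.Tr ψ (S.multiplier f) = (((2 * Real.pi : ℝ) ^ n)⁻¹ : ℝ) * ψ (∫ ξ, f ξ) := by
  have h : ∃ g, S.HasTraceSymbol (S.multiplier f) g := ⟨f, hf⟩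
  rw [Tr, dif_pos h, h.choose_spec.eq hf, invFourier]
  simp only [inner_zero_right, Complex.ofReal_zero, mul_zero, Complex.exp_zero, one_smul]
  rw [← Complex.coe_smul, map_smul, smul_eq_mul]

end TwistedSystem

end

/-! ### Limits and Taylor expansion at infinity in a half strip. -/

section

section HalfStrip

variable {V : Type*} [NormedAddCommGroup V]

/-- The closed half strip `{w : 0 ≤ Re w, a ≤ Im w ≤ b}`, the logarithmic picture of
`{μ : 1 ≤ |μ|}` in a closed sector. -/
def halfStrip (a b : ℝ) : Set ℂ := {w | 0 ≤ w.re ∧ w.im ∈ Set.Icc a b}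

theorem halfStrip_add {a b : ℝ} {w : ℂ} (hw : w ∈ halfStrip a b) {t : ℝ} (ht : 0 ≤ t) :
    w + t ∈ halfStrip a b := by
  refine ⟨?_, ?_⟩
  · simpa using add_nonneg hw.1 ht
  · simpa using hw.2

theorem mk_mem_halfStrip {a b x θ : ℝ} (hx : 0 ≤ x) (hθ : θ ∈ Set.Icc a b) :
    (x + θ * Complex.I : ℂ) ∈ halfStrip a b := by
  simpa [halfStrip, hx] using hθ

theorem norm_exp_real_mul (s : ℝ) (w : ℂ) : ‖Complex.exp (s * w)‖ = Real.exp (s * w.re) := by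
  simp [Complex.norm_exp]

theorem tendsto_exp_neg_mul_atTop {α : ℝ} (hα : 0 < α) :
    Tendsto (fun t : ℝ => Real.exp (-α * t)) atTop (𝓝 0) :=
  Real.tendsto_exp_atBot.comp (tendsto_id.const_mul_atTop_of_neg (neg_neg_of_pos hα))

/-- Decay of the horizontal and vertical increments of `g` gives a common limit of `g` along all
the horizontal half lines of a strip. -/
theorem exists_common_limit [CompleteSpace V] {lo hi α : ℝ} (hlt : lo < hi) (hα : 0 < α)
    {g : ℂ → V}
    (h : ∀ a b, lo < a → b < hi → ∃ C : ℝ,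
      (∀ w ∈ halfStrip a b, ∀ t : ℝ, 0 ≤ t → ‖g (w + t) - g w‖ ≤ C * Real.exp (-α * w.re)) ∧
      ∀ x : ℝ, 0 ≤ x → ∀ θ ∈ Set.Icc a b, ∀ θ' ∈ Set.Icc a b,
        ‖g (x + θ * Complex.I) - g (x + θ' * Complex.I)‖ ≤ C * Real.exp (-α * x)) :
    ∃ ℓ, ∀ θ ∈ Set.Ioo lo hi, Tendsto (fun t : ℝ => g (t + θ * Complex.I)) atTop (𝓝 ℓ) := by
  set θ₀ := (lo + hi) / 2 with hθ₀
  have hlo : lo < θ₀ := by rw [hθ₀]; linarith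
  have hhi : θ₀ < hi := by rw [hθ₀]; linarith
  obtain ⟨ℓ, hℓ⟩ : ∃ ℓ, Tendsto (fun t : ℝ => g (t + θ₀ * Complex.I)) atTop (𝓝 ℓ) := by
    obtain ⟨C, hC, -⟩ := h θ₀ θ₀ hlo hhi
    -- The estimates hold only for `Re w ≥ 0`; truncating the parameter at `0` does not affect the
    -- limit.
    have hcau : CauchySeq fun t : ℝ => g ((max t 0 : ℝ) + θ₀ * Complex.I) := by
      refine cauchySeq_of_le_tendsto_0 (fun N => 2 * (C * Real.exp (-α * max N 0))) ?_ ?_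
      · have key : ∀ s N : ℝ, N ≤ s → ‖g ((max s 0 : ℝ) + θ₀ * Complex.I) -
            g ((max N 0 : ℝ) + θ₀ * Complex.I)‖ ≤ C * Real.exp (-α * max N 0) := by
          intro s N hN
          have h1 : max N 0 ≤ max s 0 := max_le_max_right 0 hN
          have := hC _ (mk_mem_halfStrip (le_max_right N 0) (Set.left_mem_Icc.2 le_rfl))
            (max s 0 - max N 0) (by linarith)
          convert this using 3
          · push_cast; ring_nf
          · simp
        intro s t N hs ht
        rw [dist_eq_norm, ← sub_sub_sub_cancel_right _ _ (g ((max N 0 : ℝ) + θ₀ * Complex.I))]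
        refine (norm_sub_le _ _).trans ?_
        linarith [key s N hs, key t N ht]
      · have h1 : Tendsto (fun N : ℝ => 2 * (C * Real.exp (-α * N))) atTop (𝓝 0) := by
          simpa using ((tendsto_exp_neg_mul_atTop hα).const_mul C).const_mul 2
        refine h1.congr' ?_
        filter_upwards [eventually_ge_atTop 0] with N hN
        rw [max_eq_left hN]
    obtain ⟨ℓ, hℓ⟩ := cauchySeq_tendsto_of_complete hcau
    refine ⟨ℓ, hℓ.congr' ?_⟩
    filter_upwards [eventually_ge_atTop 0] with N hN
    rw [max_eq_left hN]
  refine ⟨ℓ, fun θ hθ => ?_⟩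
  -- The vertical increments between the two lines tend to `0`, so the limit on the central line is
  -- inherited.
  obtain ⟨C, -, hC⟩ := h (min θ θ₀) (max θ θ₀) (lt_min hθ.1 hlo) (max_lt hθ.2 hhi)
  refine tendsto_of_tendsto_of_dist hℓ ?_
  have h1 : Tendsto (fun N : ℝ => C * Real.exp (-α * N)) atTop (𝓝 0) := by
    simpa using (tendsto_exp_neg_mul_atTop hα).const_mul C
  refine squeeze_zero' (Eventually.of_forall fun _ => dist_nonneg) ?_ h1
  filter_upwards [eventually_ge_atTop 0] with t ht
  rw [dist_eq_norm]
  exact hC t ht θ₀ ⟨min_le_right _ _, le_max_right _ _⟩ θ ⟨min_le_left _ _, le_max_left _ _⟩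

theorem tendsto_add_ofReal {g : ℂ → V} {w : ℂ} {ℓ : V}
    (h : Tendsto (fun t : ℝ => g (t + w.im * Complex.I)) atTop (𝓝 ℓ)) :
    Tendsto (fun t : ℝ => g (w + t)) atTop (𝓝 ℓ) := by
  have := h.comp (tendsto_atTop_add_const_left atTop w.re tendsto_id)
  refine this.congr fun t => ?_
  simp only [Function.comp, id]
  congr 1
  conv_rhs => rw [← Complex.re_add_im w]
  push_cast
  ring

theorem norm_sub_le_of_tendsto {g : ℂ → V} {w : ℂ} {ℓ : V} {C : ℝ}
    (h : Tendsto (fun t : ℝ => g (t + w.im * Complex.I)) atTop (𝓝 ℓ))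
    (hC : ∀ t : ℝ, 0 ≤ t → ‖g (w + t) - g w‖ ≤ C) : ‖g w - ℓ‖ ≤ C := by
  rw [norm_sub_rev]
  refine le_of_tendsto ((tendsto_add_ofReal h).sub_const (g w)).norm ?_
  filter_upwards [eventually_ge_atTop 0] with t ht using hC t ht

variable [NormedSpace ℂ V]

theorem hasDerivAt_add_ofReal {g : ℂ → V} {g' : V} {w : ℂ} {s : ℝ}
    (h : HasDerivAt g g' (w + s)) : HasDerivAt (fun t : ℝ => g (w + t)) g' s := by
  have h1 : HasDerivAt (fun t : ℝ => w + (t : ℂ)) 1 s :=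
    (Complex.ofRealCLM.hasDerivAt (x := s)).const_add w
  exact (HasDerivAt.scomp s h h1).congr_deriv (one_smul _ _)

/-- Comparison with the majorant `D(1 - e^{-αs})`, whose derivative dominates that of the increment.
-/
theorem norm_add_ofReal_sub_le {g g' : ℂ → V} {C α : ℝ} {w : ℂ} (hα : 0 < α)
    (hd : ∀ s : ℝ, 0 ≤ s → HasDerivAt g (g' (w + s)) (w + s))
    (hb : ∀ s : ℝ, 0 ≤ s → ‖g' (w + s)‖ ≤ C * Real.exp (-α * (w.re + s))) {t : ℝ} (ht : 0 ≤ t) :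
    ‖g (w + t) - g w‖ ≤ C / α * Real.exp (-α * w.re) := by
  set D := C / α * Real.exp (-α * w.re) with hD
  have hC : 0 ≤ D := by
    have h := (norm_nonneg _).trans (hb 0 le_rfl)
    have : 0 ≤ C := nonneg_of_mul_nonneg_left h (Real.exp_pos _)
    positivity
  have key := image_norm_le_of_norm_deriv_right_le_deriv_boundary (a := 0) (b := t)
    (f := fun s : ℝ => g (w + s) - g w) (f' := fun s : ℝ => g' (w + s))
    (B := fun s => D * (1 - Real.exp (-α * s)))
    (B' := fun s => D * (α * Real.exp (-α * s))) ?_ ?_ ?_ ?_ ?_ (x := t) ⟨ht, le_rfl⟩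
  · refine key.trans ?_
    nlinarith [Real.exp_pos (-α * t)]
  · intro s hs
    exact ((hasDerivAt_add_ofReal (hd s hs.1)).continuousAt.sub
      continuousAt_const).continuousWithinAt
  · intro s hs
    exact ((hasDerivAt_add_ofReal (hd s hs.1)).sub_const _).hasDerivWithinAt
  · simp
  · intro s
    have h1 : HasDerivAt (fun s : ℝ => -α * s) (-α) s := by
      simpa using (hasDerivAt_id s).const_mul (-α)
    exact ((h1.exp.const_sub 1).const_mul D).congr_deriv (by ring)
  · intro s hs
    refine (hb s hs.1).trans (le_of_eq ?_)
    rw [hD, mul_add, Real.exp_add]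
    field_simp

theorem norm_vertical_sub_le {g g' : ℂ → V} {C a b x : ℝ}
    (hd : ∀ θ ∈ Set.Icc a b, HasDerivAt g (g' (x + θ * Complex.I)) (x + θ * Complex.I))
    (hb : ∀ θ ∈ Set.Icc a b, ‖g' (x + θ * Complex.I)‖ ≤ C) {θ θ' : ℝ} (hθ : θ ∈ Set.Icc a b)
    (hθ' : θ' ∈ Set.Icc a b) :
    ‖g (x + θ * Complex.I) - g (x + θ' * Complex.I)‖ ≤ C * (b - a) := by
  have hC : 0 ≤ C := (norm_nonneg _).trans (hb θ hθ)
  have h1 : ∀ s : ℝ, HasDerivAt (fun s : ℝ => (x + s * Complex.I : ℂ)) Complex.I s := fun s => by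
    simpa using ((Complex.ofRealCLM.hasDerivAt (x := s)).mul_const Complex.I).const_add (x : ℂ)
  have key := (convex_Icc a b).norm_image_sub_le_of_norm_hasDerivWithin_le
    (f := fun s : ℝ => g (x + s * Complex.I)) (f' := fun s => Complex.I • g' (x + s * Complex.I))
    (C := C) (fun s hs => (HasDerivAt.scomp s (hd s hs) (h1 s)).hasDerivWithinAt)
    (fun s hs => by simpa [norm_smul] using hb s hs) hθ' hθ
  refine key.trans (mul_le_mul_of_nonneg_left ?_ hC)
  rw [Real.norm_eq_abs, abs_le]
  constructor <;> linarith [hθ.1, hθ.2, hθ'.1, hθ'.2]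

/-- With `z = e^{-w}` this is the rule `d/dw = -z d/dz` applied to `z^{k+1}/(k+1)!`. -/
theorem hasDerivAt_exp_neg_mul (k : ℕ) (w : ℂ) :
    HasDerivAt (fun w : ℂ => Complex.exp (-((k + 1 : ℕ) * w)) / (k + 1).factorial)
      (-Complex.exp (-w) * (Complex.exp (-(k * w)) / k.factorial)) w := by
  have h1 : HasDerivAt (fun w : ℂ => -((k + 1 : ℕ) * w)) (-((k + 1 : ℕ) : ℂ)) w :=
    ((hasDerivAt_id w).const_mul ((k + 1 : ℕ) : ℂ)).fun_neg.congr_deriv (by rw [mul_one])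
  refine (h1.cexp.div_const ((k + 1).factorial : ℂ)).congr_deriv ?_
  have h2 : ((k : ℂ) + 1) ≠ 0 := by exact_mod_cast k.succ_ne_zero
  have h3 : (k.factorial : ℂ) ≠ 0 := by exact_mod_cast k.factorial_ne_zero
  rw [Nat.factorial_succ]
  have h4 : Complex.exp (-(((k + 1 : ℕ) : ℂ) * w)) = Complex.exp (-w) * Complex.exp (-(k * w)) := by
    rw [← Complex.exp_add]; push_cast; ring_nf
  rw [h4]
  push_cast
  field_simp

/-- Taylor expansion at `z = 0` in the variable `w = -log z`: the functions `Ψ k` are the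
derivatives of order `k` with respect to `z`, and `τ k` are their limits at `z = 0`. -/
theorem taylor_halfStrip {a b : ℝ} (K : ℕ) : ∀ {Ψ : ℕ → ℂ → V} {τ : ℕ → V} {C : ℝ},
    (∀ k, ∀ w ∈ halfStrip a b, HasDerivAt (Ψ k) (-(Complex.exp (-w)) • Ψ (k + 1) w) w) →
    (∀ k, ∀ θ ∈ Set.Icc a b, Tendsto (fun t : ℝ => Ψ k (t + θ * Complex.I)) atTop (𝓝 (τ k))) →
    (∀ w ∈ halfStrip a b, ‖Ψ K w‖ ≤ C) →
    ∀ w ∈ halfStrip a b,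
      ‖Ψ 0 w - ∑ k ∈ Finset.range K, (Complex.exp (-(k * w)) / k.factorial) • τ k‖ ≤
        C * Real.exp (-K * w.re) := by
  induction K with
  | zero =>
    intro Ψ τ C _ _ hC w hw
    simpa using hC w hw
  | succ K ih =>
    intro Ψ τ C hd hτ hC w hw
    have hC0 : 0 ≤ C := (norm_nonneg _).trans (hC w hw)
    -- The shifted family expands the derivative `Ψ 1`; its remainder `r` controls the derivative of
    -- `R`.
    have ih' := ih (Ψ := fun k => Ψ (k + 1)) (τ := fun k => τ (k + 1)) (C := C)
      (fun k => hd (k + 1)) (fun k => hτ (k + 1)) hC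
    set R : ℂ → V := fun w => Ψ 0 w -
      ∑ k ∈ Finset.range (K + 1), (Complex.exp (-(k * w)) / k.factorial) • τ k with hR
    set r : ℂ → V := fun w => Ψ 1 w -
      ∑ k ∈ Finset.range K, (Complex.exp (-(k * w)) / k.factorial) • τ (k + 1) with hr
    have hRd : ∀ w ∈ halfStrip a b, HasDerivAt R (-(Complex.exp (-w)) • r w) w := by
      intro w hw
      have h1 : HasDerivAt (fun w => ∑ k ∈ Finset.range (K + 1),
          (Complex.exp (-(k * w)) / k.factorial) • τ k) (∑ k ∈ Finset.range K,
          (-Complex.exp (-w) * (Complex.exp (-(k * w)) / k.factorial)) • τ (k + 1)) w := by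
        simp only [Finset.sum_range_succ' _ K]
        have := (HasDerivAt.fun_sum (u := Finset.range K) fun k _ =>
          (hasDerivAt_exp_neg_mul k w).smul_const (τ (k + 1))).add_const
            ((Complex.exp (-((0 : ℕ) * w)) / (0 : ℕ).factorial) • τ 0)
        simpa using this
      refine ((hd 0 w hw).sub h1).congr_deriv ?_
      simp only [hr, smul_sub, Finset.smul_sum, smul_smul]
    -- Only the term `k = 0` survives at infinity, where it cancels the limit of `Ψ 0`.
    have hRt : Tendsto (fun t : ℝ => R (t + w.im * Complex.I)) atTop (𝓝 0) := by
      have h2 : Tendsto (fun t : ℝ => ∑ k ∈ Finset.range (K + 1),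
          (Complex.exp (-(k * (t + w.im * Complex.I))) / k.factorial) • τ k) atTop (𝓝 (τ 0)) := by
        simp only [Finset.sum_range_succ' _ K]
        have h3 : Tendsto (fun t : ℝ => ∑ k ∈ Finset.range K,
          (Complex.exp (-((k + 1 : ℕ) * (t + w.im * Complex.I))) / (k + 1).factorial) • τ (k + 1))
            atTop (𝓝 (∑ k ∈ Finset.range K, 0)) := by
          refine tendsto_finsetSum _ fun k _ => ?_
          rw [tendsto_zero_iff_norm_tendsto_zero]
          have h4 := ((tendsto_exp_neg_mul_atTop (α := (k + 1 : ℕ))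
            (by positivity)).div_const ((k + 1).factorial : ℝ)).mul_const ‖τ (k + 1)‖
          rw [zero_div, zero_mul] at h4
          refine h4.congr fun t => ?_
          have h6 : -(((k + 1 : ℕ) : ℂ) * (t + w.im * Complex.I)) =
              ((-(k + 1 : ℕ) : ℝ) : ℂ) * (t + w.im * Complex.I) := by push_cast; ring
          rw [norm_smul, norm_div, h6, norm_exp_real_mul, Complex.norm_natCast]
          simp
        simpa using h3.add_const (τ 0)
      simpa using (hτ 0 w.im hw.2).sub h2
    -- Integrating `R'` from `w` to infinity: the factor `e^{-w}` in `R'` supplies the extra power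
    -- of decay.
    have h5 := norm_sub_le_of_tendsto (C := C / (K + 1 : ℕ) * Real.exp (-(K + 1 : ℕ) * w.re))
      hRt fun t ht => norm_add_ofReal_sub_le
      (g' := fun w => -(Complex.exp (-w)) • r w) (α := (K + 1 : ℕ)) (by positivity)
      (fun s hs => hRd _ (halfStrip_add hw hs)) (fun s hs => ?_) ht
    · rw [sub_zero] at h5
      refine h5.trans ?_
      gcongr
      exact div_le_self hC0 (by push_cast; linarith [(Nat.cast_nonneg K : (0 : ℝ) ≤ K)])
    · rw [norm_smul, norm_neg, Complex.norm_exp]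
      refine (mul_le_mul_of_nonneg_left (ih' _ (halfStrip_add hw hs)) (Real.exp_pos _).le).trans
        (le_of_eq ?_)
      rw [mul_left_comm, ← Real.exp_add]
      congr 2
      simp
      ring

end HalfStrip

end

/-! ### Sectors in logarithmic coordinates and the Taylor expansion of parametric symbols. -/

section

namespace Sector

variable (Γ : Sector)

theorem exp_eq_polar (w : ℂ) :
    Complex.exp w = (Real.exp w.re : ℝ) * Complex.exp ((w.im : ℝ) * Complex.I) := by
  rw [Complex.ofReal_exp, ← Complex.exp_add, Complex.re_add_im]

variable {Γ}

theorem exp_mem_carrier {w : ℂ} (hw : w.im ∈ Set.Ioo Γ.lo Γ.hi) : Complex.exp w ∈ Γ.carrier :=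
  ⟨Real.exp w.re, Real.exp_pos _, w.im, hw, exp_eq_polar w⟩

theorem exp_mem_closedSector {a b : ℝ} {w : ℂ} (hw : w.im ∈ Set.Icc a b) :
    Complex.exp w ∈ closedSector a b :=
  ⟨Real.exp w.re, Real.exp_pos _, w.im, hw, exp_eq_polar w⟩

theorem log_exp {w : ℂ} (hw : w.im ∈ Set.Ioo Γ.lo Γ.hi) : Γ.log (Complex.exp w) = w := by
  rw [exp_eq_polar, Γ.log_polar (Real.exp_pos _) hw, Real.log_exp, Complex.re_add_im]

theorem pow_exp {w : ℂ} (hw : w.im ∈ Set.Ioo Γ.lo Γ.hi) (s : ℝ) :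
    Γ.pow (Complex.exp w) s = Complex.exp (s * w) := by
  rw [pow, log_exp hw]

theorem exists_exp_of_mem_closedSector {a b : ℝ} {μ : ℂ} (hμ : μ ∈ closedSector a b)
    (h1 : 1 ≤ ‖μ‖) : ∃ w ∈ halfStrip a b, Complex.exp w = μ := by
  obtain ⟨r, hr, θ, hθ, rfl⟩ := hμ
  have h2 : 1 ≤ r := by simpa [Complex.norm_exp_ofReal_mul_I, abs_of_pos hr] using h1
  refine ⟨Real.log r + θ * Complex.I, mk_mem_halfStrip (Real.log_nonneg h2) hθ, ?_⟩
  rw [Complex.exp_add, ← Complex.ofReal_exp, Real.exp_log hr]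

theorem exists_exp_of_mem_carrier {μ : ℂ} (hμ : μ ∈ Γ.carrier) :
    ∃ w : ℂ, w.im ∈ Set.Ioo Γ.lo Γ.hi ∧ Complex.exp w = μ := by
  obtain ⟨r, hr, θ, hθ, rfl⟩ := hμ
  refine ⟨Real.log r + θ * Complex.I, by simpa using hθ, ?_⟩
  rw [Complex.exp_add, ← Complex.ofReal_exp, Real.exp_log hr]

theorem isOpen_carrier (Γ : Sector) : IsOpen Γ.carrier := by
  have h : Γ.carrier = Complex.exp '' (Complex.im ⁻¹' Set.Ioo Γ.lo Γ.hi) := by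
    ext μ
    constructor
    · exact fun hμ => exists_exp_of_mem_carrier hμ
    · rintro ⟨w, hw, rfl⟩
      exact exp_mem_carrier hw
  rw [h]
  exact Complex.isOpenMap_exp _ (isOpen_Ioo.preimage Complex.continuous_im)

/-- Rotating the bisector to the positive axis puts `Γ` in the slit plane, because its opening is at
most `2π`. -/
theorem differentiableOn_log (Γ : Sector) : DifferentiableOn ℂ Γ.log Γ.carrier := by
  intro μ hμ
  have hs : μ * Complex.exp (-(((Γ.lo + Γ.hi) / 2 : ℝ) * Complex.I)) ∈ Complex.slitPlane := by
    obtain ⟨w, ⟨h1, h2⟩, rfl⟩ := exists_exp_of_mem_carrier hμ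
    have hw := Γ.width_le
    rw [← Complex.exp_add, Complex.mem_slitPlane_iff_arg]
    refine ⟨?_, Complex.exp_ne_zero _⟩
    rw [← Complex.log_im, Complex.log_exp]
    · simp
      linarith
    · simp
      linarith
    · simp
      linarith
  unfold log
  exact (((differentiableAt_id.mul_const _).clog hs).add_const _).differentiableWithinAt

theorem differentiableOn_pow (Γ : Sector) (s : ℝ) :
    DifferentiableOn ℂ (fun μ => Γ.pow μ s) Γ.carrier :=
  (Γ.differentiableOn_log.const_mul (s : ℂ)).cexp

end Sector

theorem im_mem_Ioo {Γ : Sector} {a b : ℝ} (ha : Γ.lo < a) (hb : b < Γ.hi) {w : ℂ}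
    (hw : w ∈ halfStrip a b) : w.im ∈ Set.Ioo Γ.lo Γ.hi :=
  ⟨ha.trans_le hw.2.1, hw.2.2.trans_lt hb⟩

variable {n : ℕ} {A : Type*} [CStarAlgebra A]

/-- The part of the definition of `S^{M,d}` that concerns no derivatives in `ξ` and in the
algebra. -/
structure IsParamSymbol (Γ : Sector) (M d : ℝ) (h : E n → ℂ → A) : Prop where
  continuousOn : ContinuousOn (fun p : E n × ℂ => h p.1 p.2) (Set.univ ×ˢ Γ.carrier)
  holomorphic : ∀ ξ, DifferentiableOn ℂ (h ξ) Γ.carrier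
  continuous_zDeriv : ∀ (j : ℕ) (z : ℂ), z⁻¹ ∈ Γ.carrier → Continuous (zDeriv Γ d h j z)
  bound : ∀ (j : ℕ) (a b : ℝ), Γ.lo < a → b < Γ.hi → ∃ C : ℝ, 0 ≤ C ∧
    ∀ w ∈ halfStrip a b, ∀ ξ : E n, ‖zDeriv Γ d h j (Complex.exp (-w)) ξ‖ ≤ C * jb ξ ^ (M + j)

theorem IsWeakSymbol.isParamSymbol {S : TwistedSystem n A} {Γ : Sector} {M d : ℝ}
    {h : E n → ℂ → A} (hh : IsWeakSymbol S Γ M d h) : IsParamSymbol Γ M d h where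
  continuousOn := by
    have := (hh.smooth.2 0).continuousOn
    simpa only [S.delta_zero] using this
  holomorphic ξ := by simpa only [S.delta_zero] using hh.holomorphic ξ 0
  continuous_zDeriv j z hz := (hh.symbol j z hz).continuous
  bound j a b ha hb := by
    obtain ⟨C, hC⟩ := hh.uniform j a b ha hb 0 0
    simp only [S.delta_zero, pderiv_zero, mlen_zero, Nat.cast_zero, sub_zero] at hC
    refine ⟨max C 0, le_max_right _ _, fun w hw ξ => ?_⟩
    refine (hC _ ?_ ?_ ξ).trans ?_
    · rw [← Complex.exp_neg, neg_neg]
      exact Sector.exp_mem_closedSector hw.2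
    · simpa [Complex.norm_exp] using hw.1
    · exact mul_le_mul_of_nonneg_right (le_max_left _ _) (Real.rpow_nonneg (jb_pos ξ).le _)

theorem zDeriv_zero_exp {Γ : Sector} {d : ℝ} (h : E n → ℂ → A) {w : ℂ}
    (hw : w.im ∈ Set.Ioo Γ.lo Γ.hi) (ξ : E n) :
    zDeriv Γ d h 0 (Complex.exp (-w)) ξ = Complex.exp (-(d * w)) • h ξ (Complex.exp w) := by
  rw [zDeriv, iteratedDeriv_zero, ← Complex.exp_neg, neg_neg, Sector.pow_exp hw]
  push_cast
  rw [neg_mul]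

namespace IsParamSymbol

variable {Γ : Sector} {M d : ℝ} {h : E n → ℂ → A}

/-- Holomorphy in `μ` makes `z^d h(ξ, 1/z)` analytic on the inverted sector, so every iterated
derivative can be differentiated again; the factor is `dz/dw`. -/
theorem hasDerivAt_zDeriv (hh : IsParamSymbol Γ M d h) (k : ℕ) (ξ : E n) {w : ℂ}
    (hw : w.im ∈ Set.Ioo Γ.lo Γ.hi) :
    HasDerivAt (fun w => zDeriv Γ d h k (Complex.exp (-w)) ξ)
      (-(Complex.exp (-w)) • zDeriv Γ d h (k + 1) (Complex.exp (-w)) ξ) w := by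
  set U : Set ℂ := {z | z ≠ 0 ∧ z⁻¹ ∈ Γ.carrier} with hU
  have hUo : IsOpen U :=
    (continuousOn_inv₀ (G₀ := ℂ)).isOpen_inter_preimage isOpen_compl_singleton Γ.isOpen_carrier
  have hinv : DifferentiableOn ℂ (fun z : ℂ => z⁻¹) U := fun z hz =>
    (differentiableAt_inv hz.1).differentiableWithinAt
  have hmaps : Set.MapsTo (fun z : ℂ => z⁻¹) U Γ.carrier := fun z hz => hz.2
  have hdiff : DifferentiableOn ℂ (fun z : ℂ => Γ.pow z⁻¹ (-d) • h ξ z⁻¹) U :=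
    ((Γ.differentiableOn_pow (-d)).comp hinv hmaps).smul ((hh.holomorphic ξ).comp hinv hmaps)
  have hz : Complex.exp (-w) ∈ U := by
    refine ⟨Complex.exp_ne_zero _, ?_⟩
    rw [← Complex.exp_neg, neg_neg]
    exact Sector.exp_mem_carrier hw
  have han := (hdiff.analyticOnNhd hUo).iterated_deriv k _ hz
  have h1 : HasDerivAt (iteratedDeriv k fun z : ℂ => Γ.pow z⁻¹ (-d) • h ξ z⁻¹)
      (zDeriv Γ d h (k + 1) (Complex.exp (-w)) ξ) (Complex.exp (-w)) := by
    rw [zDeriv, iteratedDeriv_succ]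
    rw [← iteratedDeriv_eq_iterate] at han
    exact han.differentiableAt.hasDerivAt
  have h2 : HasDerivAt (fun w : ℂ => Complex.exp (-w)) (-Complex.exp (-w)) w := by
    simpa using (hasDerivAt_neg w).cexp
  exact h1.scomp w h2

/-- The next `z`-derivative is bounded for fixed `ξ`, so the `w`-derivative is `O(e^{-Re w})` and
the increments decay. -/
theorem exists_limit (hh : IsParamSymbol Γ M d h) (k : ℕ) (ξ : E n) :
    ∃ ℓ, ∀ θ ∈ Set.Ioo Γ.lo Γ.hi, Tendsto
      (fun t : ℝ => zDeriv Γ d h k (Complex.exp (-(t + θ * Complex.I))) ξ) atTop (𝓝 ℓ) := by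
  refine exists_common_limit (α := 1) (g := fun w => zDeriv Γ d h k (Complex.exp (-w)) ξ)
    Γ.lo_lt_hi zero_lt_one fun a b ha hb => ?_
  obtain ⟨C, hC0, hC⟩ := hh.bound (k + 1) a b ha hb
  set D := C * jb ξ ^ (M + (k + 1 : ℕ)) with hD
  have hD0 : 0 ≤ D := mul_nonneg hC0 (Real.rpow_nonneg (jb_pos ξ).le _)
  have hd : ∀ w ∈ halfStrip a b,
      ‖-(Complex.exp (-w)) • zDeriv Γ d h (k + 1) (Complex.exp (-w)) ξ‖ ≤
        D * Real.exp (-1 * w.re) := by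
    intro w hw
    rw [norm_smul, norm_neg, Complex.norm_exp, mul_comm, Complex.neg_re, neg_one_mul]
    exact mul_le_mul_of_nonneg_right (hC w hw ξ) (Real.exp_pos _).le
  refine ⟨D * (1 + |b - a|), fun w hw t ht => ?_, fun x hx θ hθ θ' hθ' => ?_⟩
  · refine (norm_add_ofReal_sub_le (g' := fun w => -(Complex.exp (-w)) •
      zDeriv Γ d h (k + 1) (Complex.exp (-w)) ξ) (C := D) zero_lt_one
      (fun s hs => hh.hasDerivAt_zDeriv k ξ (im_mem_Ioo ha hb (halfStrip_add hw hs)))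
      (fun s hs => (hd _ (halfStrip_add hw hs)).trans (le_of_eq (by simp))) ht).trans ?_
    gcongr
    nlinarith [mul_nonneg hD0 (abs_nonneg (b - a))]
  · refine (norm_vertical_sub_le (g := fun w => zDeriv Γ d h k (Complex.exp (-w)) ξ)
      (g' := fun w => -(Complex.exp (-w)) • zDeriv Γ d h (k + 1) (Complex.exp (-w)) ξ)
      (C := D * Real.exp (-1 * x)) (fun s hs => hh.hasDerivAt_zDeriv k ξ
        (im_mem_Ioo ha hb (mk_mem_halfStrip hx hs)))
      (fun s hs => (hd _ (mk_mem_halfStrip hx hs)).trans (le_of_eq (by simp))) hθ hθ').trans ?_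
    have h1 := le_abs_self (b - a)
    have h2 := mul_nonneg hD0 (Real.exp_pos (-1 * x)).le
    nlinarith [mul_le_mul_of_nonneg_left h1 h2]

/-- Taylor expansion of `z^d h(ξ, 1/z)` at `z = 0` with `z = exp (-w)`. -/
theorem exists_taylor (hh : IsParamSymbol Γ M d h) : ∃ τ : ℕ → E n → A,
    (∀ k, StronglyMeasurable (τ k)) ∧
    (∀ k, ∃ C : ℝ, 0 ≤ C ∧ ∀ ξ, ‖τ k ξ‖ ≤ C * jb ξ ^ (M + k)) ∧
    ∀ (a b : ℝ), Γ.lo < a → b < Γ.hi → ∀ K : ℕ, ∃ C : ℝ, 0 ≤ C ∧ ∀ w ∈ halfStrip a b, ∀ ξ,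
      ‖Complex.exp (-(d * w)) • h ξ (Complex.exp w) -
        ∑ k ∈ Finset.range K, Complex.exp (-(k * w)) • τ k ξ‖ ≤
          C * jb ξ ^ (M + K) * Real.exp (-K * w.re) := by
  choose ℓ hℓ using hh.exists_limit
  set θ₀ := (Γ.lo + Γ.hi) / 2 with hθ₀
  have h0 := Γ.lo_lt_hi
  have hlo : Γ.lo < θ₀ := by rw [hθ₀]; linarith
  have hhi : θ₀ < Γ.hi := by rw [hθ₀]; linarith
  refine ⟨fun k ξ => (k.factorial : ℂ)⁻¹ • ℓ k ξ, fun k => ?_, fun k => ?_, fun a b ha hb K => ?_⟩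
  -- The coefficients are pointwise limits of continuous functions along a sequence on the central
  -- ray.
  · refine StronglyMeasurable.const_smul (stronglyMeasurable_of_tendsto (u := atTop)
      (f := fun (t : ℕ) ξ => zDeriv Γ d h k (Complex.exp (-((t : ℝ) + θ₀ * Complex.I))) ξ)
      (fun t => (hh.continuous_zDeriv k _ ?_).stronglyMeasurable) ?_) _
    · rw [← Complex.exp_neg, neg_neg]
      exact Sector.exp_mem_carrier (by simpa using ⟨hlo, hhi⟩)
    · exact tendsto_pi_nhds.2 fun ξ => (hℓ k ξ θ₀ ⟨hlo, hhi⟩).comp tendsto_natCast_atTop_atTop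
  · obtain ⟨C, hC0, hC⟩ := hh.bound k θ₀ θ₀ hlo hhi
    refine ⟨C, hC0, fun ξ => ?_⟩
    have h1 : ‖ℓ k ξ‖ ≤ C * jb ξ ^ (M + k) := by
      refine le_of_tendsto (hℓ k ξ θ₀ ⟨hlo, hhi⟩).norm ?_
      filter_upwards [eventually_ge_atTop 0] with t ht
      exact hC _ (mk_mem_halfStrip ht (Set.left_mem_Icc.2 le_rfl)) ξ
    rw [norm_smul]
    refine (mul_le_of_le_one_left (norm_nonneg _) ?_).trans h1
    rw [norm_inv, Complex.norm_natCast]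
    exact inv_le_one_of_one_le₀ (by exact_mod_cast k.factorial_pos)
  · obtain ⟨C, hC0, hC⟩ := hh.bound K a b ha hb
    refine ⟨C, hC0, fun w hw ξ => ?_⟩
    have := taylor_halfStrip K (Ψ := fun k w => zDeriv Γ d h k (Complex.exp (-w)) ξ)
      (τ := fun k => ℓ k ξ) (C := C * jb ξ ^ (M + K))
      (fun k w hw => hh.hasDerivAt_zDeriv k ξ (im_mem_Ioo ha hb hw))
      (fun k θ hθ => hℓ k ξ θ ⟨ha.trans_le hθ.1, hθ.2.trans_lt hb⟩)
      (fun w hw => hC w hw ξ) w hw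
    rw [zDeriv_zero_exp h (im_mem_Ioo ha hb hw)] at this
    simpa only [smul_smul, div_eq_mul_inv] using this

theorem continuous_exp (hh : IsParamSymbol Γ M d h) {w : ℂ} (hw : w.im ∈ Set.Ioo Γ.lo Γ.hi) :
    Continuous fun ξ => h ξ (Complex.exp w) :=
  hh.continuousOn.comp_continuous (f := fun ξ : E n => (ξ, Complex.exp w)) (by fun_prop)
    fun _ => ⟨Set.mem_univ _, Sector.exp_mem_carrier hw⟩

theorem norm_le (hh : IsParamSymbol Γ M d h) {a b : ℝ} (ha : Γ.lo < a) (hb : b < Γ.hi) :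
    ∃ C : ℝ, 0 ≤ C ∧ ∀ w ∈ halfStrip a b, ∀ ξ,
      ‖h ξ (Complex.exp w)‖ ≤ C * Real.exp (d * w.re) * jb ξ ^ M := by
  obtain ⟨C, hC0, hC⟩ := hh.bound 0 a b ha hb
  refine ⟨C, hC0, fun w hw ξ => ?_⟩
  have h1 := hC w hw ξ
  rw [zDeriv_zero_exp h (im_mem_Ioo ha hb hw), norm_smul, ← neg_mul, ← Complex.ofReal_neg,
    norm_exp_real_mul, Nat.cast_zero, add_zero, neg_mul, Real.exp_neg,
    inv_mul_le_iff₀ (Real.exp_pos _)] at h1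
  linarith

theorem integrable_of_integrable_jb (hh : IsParamSymbol Γ M d h) {ν : Measure (E n)}
    (hν : Integrable (fun ξ => jb ξ ^ M) ν) {w : ℂ} (h0 : 0 ≤ w.re)
    (hw : w.im ∈ Set.Ioo Γ.lo Γ.hi) : Integrable (fun ξ => h ξ (Complex.exp w)) ν := by
  -- For a single `w` the degenerate strip with both edges at `Im w` suffices.
  obtain ⟨C, -, hC⟩ := hh.norm_le hw.1 hw.2
  exact (hν.const_mul _).mono' (hh.continuous_exp hw).aestronglyMeasurable
    (Eventually.of_forall (hC w ⟨h0, le_rfl, le_rfl⟩))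

/-- Integrated Taylor expansion. -/
theorem integral_expansion {τ : ℕ → E n → A} (hh : IsParamSymbol Γ M d h)
    (hτm : ∀ k, StronglyMeasurable (τ k))
    (hτb : ∀ k, ∃ C : ℝ, 0 ≤ C ∧ ∀ ξ, ‖τ k ξ‖ ≤ C * jb ξ ^ (M + k))
    {a b : ℝ} (ha : Γ.lo < a) (hb : b < Γ.hi) {K : ℕ}
    (hτ : ∃ C : ℝ, 0 ≤ C ∧ ∀ w ∈ halfStrip a b, ∀ ξ,
      ‖Complex.exp (-(d * w)) • h ξ (Complex.exp w) -
        ∑ k ∈ Finset.range K, Complex.exp (-(k * w)) • τ k ξ‖ ≤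
          C * jb ξ ^ (M + K) * Real.exp (-K * w.re))
    {ν : Measure (E n)} (hν : ∀ k ≤ K, Integrable (fun ξ => jb ξ ^ (M + k)) ν) :
    ∃ C : ℝ, ∀ w ∈ halfStrip a b,
      ‖∫ ξ, h ξ (Complex.exp w) ∂ν -
        ∑ k ∈ Finset.range K, Complex.exp ((d - k) * w) • ∫ ξ, τ k ξ ∂ν‖ ≤
          C * Real.exp ((d - K) * w.re) := by
  obtain ⟨C, hC0, hC⟩ := hτ
  refine ⟨C * ∫ ξ, jb ξ ^ (M + K) ∂ν, fun w hw => ?_⟩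
  have hwi := im_mem_Ioo ha hb hw
  have hi1 : Integrable (fun ξ => h ξ (Complex.exp w)) ν :=
    hh.integrable_of_integrable_jb (by simpa using hν 0 (Nat.zero_le K)) hw.1 hwi
  have hi2 : ∀ k ∈ Finset.range K, Integrable (fun ξ => Complex.exp ((d - k) * w) • τ k ξ) ν := by
    intro k hk
    obtain ⟨D, -, hD⟩ := hτb k
    exact (((hν k (Finset.mem_range.1 hk).le).const_mul D).mono' (hτm k).aestronglyMeasurable
      (Eventually.of_forall hD)).smul (Complex.exp ((d - k) * w))
  simp only [← integral_smul]
  rw [← integral_finsetSum _ hi2, ← integral_sub hi1 (integrable_finsetSum _ hi2)]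
  refine (norm_integral_le_of_norm_le (((hν K le_rfl).const_mul C).mul_const
    (Real.exp ((d - K) * w.re))) (Eventually.of_forall fun ξ => ?_)).trans (le_of_eq ?_)
  · have h1 : h ξ (Complex.exp w) - ∑ k ∈ Finset.range K, Complex.exp ((d - k) * w) • τ k ξ =
        Complex.exp (d * w) • (Complex.exp (-(d * w)) • h ξ (Complex.exp w) -
        ∑ k ∈ Finset.range K, Complex.exp (-(k * w)) • τ k ξ) := by
      rw [smul_sub, smul_smul, ← Complex.exp_add, add_neg_cancel, Complex.exp_zero, one_smul,
        Finset.smul_sum]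
      simp only [smul_smul, ← Complex.exp_add, sub_eq_add_neg, add_mul, neg_mul]
    rw [h1, norm_smul, norm_exp_real_mul]
    refine (mul_le_mul_of_nonneg_left (hC w hw ξ) (Real.exp_pos _).le).trans (le_of_eq ?_)
    rw [sub_mul, sub_eq_add_neg, Real.exp_add]
    ring_nf
  · rw [integral_mul_const, integral_const_mul]

end IsParamSymbol

end

/-! ### Primitives in a strip, integrated from minus infinity. -/

section

section Primitive

variable {V : Type*} [NormedAddCommGroup V] [NormedSpace ℂ V]

/-- The integral of `q` along the horizontal half line that ends at `w`. -/
def horizontalIntegral (q : ℂ → V) (w : ℂ) : V := ∫ s : ℝ in Set.Iic w.re, q (s + w.im * Complex.I)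

/-- The primitive `w` or `e^{sw} / s` of `e^{sw}`. -/
def expPrimitive (s : ℝ) (w : ℂ) : ℂ := if s = 0 then w else Complex.exp (s * w) / s

theorem hasDerivAt_expPrimitive (s : ℝ) (w : ℂ) :
    HasDerivAt (expPrimitive s) (Complex.exp (s * w)) w := by
  unfold expPrimitive
  split_ifs with h
  · exact (hasDerivAt_id' w).congr_deriv (by simp [h])
  · have h1 : HasDerivAt (fun w : ℂ => s * w) s w := by
      simpa using (hasDerivAt_id w).const_mul (s : ℂ)
    refine (h1.cexp.div_const (s : ℂ)).congr_deriv ?_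
    have : (s : ℂ) ≠ 0 := by exact_mod_cast h
    field_simp

theorem continuous_line (θ : ℝ) : Continuous fun s : ℝ => (s + θ * Complex.I : ℂ) := by fun_prop

theorem continuous_vertical (x : ℝ) : Continuous fun y : ℝ => (x + y * Complex.I : ℂ) := by
  fun_prop

variable {q : ℂ → V} {a b ε D : ℝ}

theorem continuous_comp_line (hq : DifferentiableOn ℂ q (Complex.im ⁻¹' Set.Icc a b))
    {θ : ℝ} (hθ : θ ∈ Set.Icc a b) : Continuous fun s : ℝ => q (s + θ * Complex.I) :=
  hq.continuousOn.comp_continuous (continuous_line θ) fun s => by simpa using hθ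

theorem integrableOn_line (hq : DifferentiableOn ℂ q (Complex.im ⁻¹' Set.Icc a b))
    (hε : 0 < ε) (hD : ∀ w : ℂ, w.re ≤ 0 → w.im ∈ Set.Icc a b → ‖q w‖ ≤ D * Real.exp (ε * w.re))
    {θ : ℝ} (hθ : θ ∈ Set.Icc a b) (x : ℝ) :
    IntegrableOn (fun s : ℝ => q (s + θ * Complex.I)) (Set.Iic x) := by
  have hc := continuous_comp_line hq hθ
  have h0 : IntegrableOn (fun s : ℝ => q (s + θ * Complex.I)) (Set.Iic 0) := by
    refine Integrable.mono' ((integrableOn_exp_mul_Iic hε 0).const_mul D)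
      hc.aestronglyMeasurable ?_
    filter_upwards [ae_restrict_mem measurableSet_Iic] with s hs
    simpa using hD (s + θ * Complex.I) (by simpa using hs) (by simpa using hθ)
  refine (h0.union (hc.integrableOn_Icc (a := 0) (b := x))).mono_set fun s hs => ?_
  rcases le_total s 0 with h | h
  · exact Or.inl h
  · exact Or.inr ⟨h, hs⟩

theorem horizontalIntegral_add_sub (hq : DifferentiableOn ℂ q (Complex.im ⁻¹' Set.Icc a b))
    (hε : 0 < ε) (hD : ∀ w : ℂ, w.re ≤ 0 → w.im ∈ Set.Icc a b → ‖q w‖ ≤ D * Real.exp (ε * w.re))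
    {w : ℂ} (hw : w.im ∈ Set.Icc a b) (t : ℝ) :
    horizontalIntegral q (w + t) - horizontalIntegral q w =
      ∫ s in w.re..(w.re + t), q (s + w.im * Complex.I) := by
  rw [← intervalIntegral.integral_Iic_sub_Iic (integrableOn_line hq hε hD hw _)
    (integrableOn_line hq hε hD hw _)]
  simp [horizontalIntegral]

theorem tendsto_vertical_integral (hε : 0 < ε)
    (hD : ∀ w : ℂ, w.re ≤ 0 → w.im ∈ Set.Icc a b → ‖q w‖ ≤ D * Real.exp (ε * w.re))
    {θ θ' : ℝ} (hθ : θ ∈ Set.Icc a b) (hθ' : θ' ∈ Set.Icc a b) :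
    Tendsto (fun T : ℝ => ∫ y in θ..θ', q (T + y * Complex.I)) atBot (𝓝 0) := by
  have h1 : Tendsto (fun T : ℝ => D * Real.exp (ε * T) * |θ' - θ|) atBot (𝓝 0) := by
    have : Tendsto (fun T : ℝ => Real.exp (ε * T)) atBot (𝓝 0) :=
      Real.tendsto_exp_atBot.comp (tendsto_id.const_mul_atBot hε)
    simpa using (this.const_mul D).mul_const |θ' - θ|
  refine squeeze_zero_norm' ?_ h1
  filter_upwards [eventually_le_atBot 0] with T hT
  refine intervalIntegral.norm_integral_le_of_norm_le_const fun y hy => ?_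
  have hy' : y ∈ Set.Icc a b := by
    rcases le_total θ θ' with h | h
    · rw [Set.uIoc_of_le h] at hy
      exact ⟨hθ.1.trans hy.1.le, hy.2.trans hθ'.2⟩
    · rw [Set.uIoc_of_ge h] at hy
      exact ⟨hθ'.1.trans hy.1.le, hy.2.trans hθ.2⟩
  simpa using hD (T + y * Complex.I) (by simpa using hT) (by simpa using hy')

/-- Cauchy's theorem on a rectangle whose left edge is moved to `-∞`, where its contribution
vanishes. Thus the horizontal integral also changes in the vertical direction as a primitive of `q`
does. -/
theorem horizontalIntegral_vertical_sub [CompleteSpace V]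
    (hq : DifferentiableOn ℂ q (Complex.im ⁻¹' Set.Icc a b)) (hε : 0 < ε)
    (hD : ∀ w : ℂ, w.re ≤ 0 → w.im ∈ Set.Icc a b → ‖q w‖ ≤ D * Real.exp (ε * w.re))
    {θ θ' : ℝ} (hθ : θ ∈ Set.Icc a b) (hθ' : θ' ∈ Set.Icc a b) (x : ℝ) :
    horizontalIntegral q (x + θ' * Complex.I) - horizontalIntegral q (x + θ * Complex.I) =
      Complex.I • ∫ y in θ..θ', q (x + y * Complex.I) := by
  have hrect : ∀ T : ℝ, (∫ s in T..x, q (s + θ * Complex.I)) - (∫ s in T..x, q (s + θ' * Complex.I))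
      + Complex.I • (∫ y in θ..θ', q (x + y * Complex.I)) -
      Complex.I • (∫ y in θ..θ', q (T + y * Complex.I)) = 0 := by
    intro T
    have := Complex.integral_boundary_rect_eq_zero_of_differentiableOn q (T + θ * Complex.I)
      (x + θ' * Complex.I) (hq.mono fun w hw => ?_)
    · simpa using this
    · have h2 := hw.2
      simp only [Complex.add_im, Complex.ofReal_im, Complex.mul_im, Complex.ofReal_re,
        Complex.I_im, mul_one, Complex.I_re, mul_zero, add_zero, zero_add] at h2
      exact Set.uIcc_subset_Icc hθ hθ' h2
  have hl1 := intervalIntegral_tendsto_integral_Iic x (integrableOn_line hq hε hD hθ x) tendsto_id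
  have hl2 := intervalIntegral_tendsto_integral_Iic x (integrableOn_line hq hε hD hθ' x) tendsto_id
  have hl3 := (tendsto_vertical_integral hε hD hθ hθ').const_smul Complex.I
  have hlim := (((hl1.sub hl2).add_const
    (Complex.I • ∫ y in θ..θ', q (x + y * Complex.I))).sub hl3)
  have h0 := tendsto_nhds_unique hlim (tendsto_const_nhds.congr fun T => (hrect T).symm)
  have h1 : ∀ η : ℝ, horizontalIntegral q (x + η * Complex.I) =
      ∫ s in Set.Iic x, q (s + η * Complex.I) := fun η => by simp [horizontalIntegral]
  rw [h1, h1]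
  rw [smul_zero, sub_zero] at h0
  rw [← sub_eq_zero, ← neg_eq_zero, ← h0]
  abel

variable {P p : ℂ → V} {C α : ℝ}

/-- The increment is the integral of `q - p` along a horizontal segment, and this difference is
exponentially small. -/
theorem norm_horizontal_increment_le
    (hq : DifferentiableOn ℂ q (Complex.im ⁻¹' Set.Icc a b)) (hε : 0 < ε)
    (hD : ∀ w : ℂ, w.re ≤ 0 → w.im ∈ Set.Icc a b → ‖q w‖ ≤ D * Real.exp (ε * w.re))
    (hP : ∀ w, HasDerivAt P (p w) w) (hp : Continuous p) (hα : 0 < α)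
    (hC : ∀ w ∈ halfStrip a b, ‖q w - p w‖ ≤ C * Real.exp (-α * w.re)) [CompleteSpace V]
    {w : ℂ} (hw : w ∈ halfStrip a b) {t : ℝ} (ht : 0 ≤ t) :
    ‖(horizontalIntegral q (w + t) - P (w + t)) - (horizontalIntegral q w - P w)‖ ≤
      C / α * Real.exp (-α * w.re) := by
  have hC0 : 0 ≤ C := nonneg_of_mul_nonneg_left ((norm_nonneg _).trans (hC w hw)) (Real.exp_pos _)
  have hline : ∀ s : ℝ, w.re ≤ s → (s + w.im * Complex.I : ℂ) ∈ halfStrip a b := fun s hs =>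
    mk_mem_halfStrip (hw.1.trans hs) hw.2
  have hpc : Continuous fun s : ℝ => p (s + w.im * Complex.I) := hp.comp (continuous_line w.im)
  have h1 : P (w + t) - P w = ∫ s in w.re..(w.re + t), p (s + w.im * Complex.I) := by
    rw [intervalIntegral.integral_eq_sub_of_hasDerivAt
      (f := fun s : ℝ => P (s + w.im * Complex.I))]
    · congr 2
      · conv_lhs => rw [← Complex.re_add_im w]
        push_cast
        ring
      · exact (Complex.re_add_im w).symm
    · intro s _
      have := hasDerivAt_add_ofReal (w := w.im * Complex.I) (s := s) (hP _)
      simpa only [add_comm] using this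
    · exact hpc.intervalIntegrable _ _
  rw [sub_sub_sub_comm, horizontalIntegral_add_sub hq hε hD hw.2, h1,
    ← intervalIntegral.integral_sub ((continuous_comp_line hq hw.2).intervalIntegrable _ _)
    (hpc.intervalIntegrable _ _)]
  have h2 : ∀ s : ℝ, HasDerivAt (fun s => -(C / α) * Real.exp (-α * s))
      (C * Real.exp (-α * s)) s := by
    intro s
    have h3 : HasDerivAt (fun s : ℝ => -α * s) (-α) s := by
      simpa using (hasDerivAt_id s).const_mul (-α)
    exact (h3.exp.const_mul (-(C / α))).congr_deriv (by field_simp)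
  have hint : IntervalIntegrable (fun s => C * Real.exp (-α * s)) volume w.re (w.re + t) :=
    Continuous.intervalIntegrable (by fun_prop) _ _
  refine (intervalIntegral.norm_integral_le_of_norm_le (by linarith)
    (g := fun s => C * Real.exp (-α * s)) (Eventually.of_forall fun s hs => ?_) hint).trans ?_
  · simpa using hC _ (hline s hs.1.le)
  · rw [intervalIntegral.integral_eq_sub_of_hasDerivAt (fun s _ => h2 s) hint]
    have : 0 ≤ C / α * Real.exp (-α * (w.re + t)) := by positivity
    linarith

/-- The vertical counterpart, with Cauchy's theorem giving the increment of the horizontal integral.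
It is what makes the integration constant independent of the ray. -/
theorem norm_vertical_increment_le [CompleteSpace V]
    (hq : DifferentiableOn ℂ q (Complex.im ⁻¹' Set.Icc a b)) (hε : 0 < ε)
    (hD : ∀ w : ℂ, w.re ≤ 0 → w.im ∈ Set.Icc a b → ‖q w‖ ≤ D * Real.exp (ε * w.re))
    (hP : ∀ w, HasDerivAt P (p w) w) (hp : Continuous p)
    (hC : ∀ w ∈ halfStrip a b, ‖q w - p w‖ ≤ C * Real.exp (-α * w.re))
    {x : ℝ} (hx : 0 ≤ x) {θ θ' : ℝ} (hθ : θ ∈ Set.Icc a b) (hθ' : θ' ∈ Set.Icc a b) :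
    ‖(horizontalIntegral q (x + θ' * Complex.I) - P (x + θ' * Complex.I)) -
      (horizontalIntegral q (x + θ * Complex.I) - P (x + θ * Complex.I))‖ ≤
      C * (b - a) * Real.exp (-α * x) := by
  have hC0 : 0 ≤ C := nonneg_of_mul_nonneg_left
    ((norm_nonneg _).trans (hC _ (mk_mem_halfStrip hx hθ))) (Real.exp_pos _)
  have hsub : Set.uIcc θ θ' ⊆ Set.Icc a b := Set.uIcc_subset_Icc hθ hθ'
  have hqc : ContinuousOn (fun y : ℝ => q (x + y * Complex.I)) (Set.uIcc θ θ') :=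
    hq.continuousOn.comp (continuous_vertical x).continuousOn
      fun y hy => by simpa using hsub hy
  have hpc : Continuous fun y : ℝ => p (x + y * Complex.I) := hp.comp (continuous_vertical x)
  have h1 : P (x + θ' * Complex.I) - P (x + θ * Complex.I) =
      Complex.I • ∫ y in θ..θ', p (x + y * Complex.I) := by
    rw [← intervalIntegral.integral_smul, intervalIntegral.integral_eq_sub_of_hasDerivAt
      (f := fun y : ℝ => P (x + y * Complex.I))]
    · intro y _
      have h2 : HasDerivAt (fun s : ℝ => (x + s * Complex.I : ℂ)) Complex.I y := by
        simpa using ((Complex.ofRealCLM.hasDerivAt (x := y)).mul_const Complex.I).const_add (x : ℂ)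
      exact HasDerivAt.scomp y (hP _) h2
    · exact (hpc.const_smul Complex.I).intervalIntegrable _ _
  rw [sub_sub_sub_comm, horizontalIntegral_vertical_sub hq hε hD hθ hθ', h1, ← smul_sub,
    ← intervalIntegral.integral_sub hqc.intervalIntegrable (hpc.intervalIntegrable _ _),
    norm_smul, Complex.norm_I, one_mul]
  refine (intervalIntegral.norm_integral_le_of_norm_le_const (C := C * Real.exp (-α * x))
    fun y hy => ?_).trans ?_
  · simpa using hC _ (mk_mem_halfStrip hx (hsub (Set.uIoc_subset_uIcc hy)))
  · have h3 : |θ' - θ| ≤ b - a := by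
      rw [abs_le]
      constructor <;> linarith [hθ.1, hθ.2, hθ'.1, hθ'.2]
    rw [mul_right_comm]
    gcongr

end Primitive

end

/-! ### Polar coordinates with logarithmic radius. -/

section

variable {n : ℕ}

section Polar

variable {V : Type*} [NormedAddCommGroup V] [NormedSpace ℝ V]

theorem integral_volumeIoiPow (k : ℕ) (g : ℝ → V) :
    ∫ r : Set.Ioi (0 : ℝ), g r ∂Measure.volumeIoiPow k = ∫ r in Set.Ioi (0 : ℝ), r ^ k • g r := by
  simp only [Measure.volumeIoiPow, ENNReal.ofReal]
  rw [integral_withDensity_eq_integral_smul (by fun_prop),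
    integral_subtype_comap measurableSet_Ioi fun a => Real.toNNReal (a ^ k) • g a,
    setIntegral_congr_fun measurableSet_Ioi fun x hx => ?_]
  simp only [NNReal.smul_def, Real.coe_toNNReal _ (pow_nonneg hx.out.le _)]

theorem integral_Ioi_one_eq_integral_exp (g : ℝ → V) :
    ∫ r in Set.Ioi (1 : ℝ), g r = ∫ t in Set.Ioi (0 : ℝ), Real.exp t • g (Real.exp t) := by
  have himg : Real.exp '' Set.Ioi 0 = Set.Ioi 1 := by
    ext r
    constructor
    · rintro ⟨t, ht, rfl⟩
      exact Real.one_lt_exp_iff.2 ht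
    · intro hr
      exact ⟨Real.log r, Real.log_pos hr, Real.exp_log (zero_lt_one.trans hr)⟩
  rw [← himg, integral_image_eq_integral_abs_deriv_smul measurableSet_Ioi
    (fun t _ => (Real.hasDerivAt_exp t).hasDerivWithinAt) Real.exp_injective.injOn]
  simp only [Real.abs_exp]

/-- Polar coordinates outside the unit ball, with the logarithm of the radius as coordinate. -/
theorem integral_compl_closedBall {h : E n → V}
    (hh : IntegrableOn h (Metric.closedBall 0 1)ᶜ) :
    Integrable (fun η : Metric.sphere (0 : E n) 1 =>
      ∫ t in Set.Ioi (0 : ℝ), Real.exp t ^ n • h (Real.exp t • η))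
      (volume : Measure (E n)).toSphere ∧
    ∫ ξ in (Metric.closedBall 0 1)ᶜ, h ξ = ∫ η : Metric.sphere (0 : E n) 1,
      (∫ t in Set.Ioi (0 : ℝ), Real.exp t ^ n • h (Real.exp t • η))
        ∂(volume : Measure (E n)).toSphere := by
  -- For `n = 0` the sphere and the complement of the ball are both empty; polar coordinates need `n
  -- > 0`.
  rcases Nat.eq_zero_or_pos n with rfl | hn
  · have hE : IsEmpty (Metric.sphere (0 : E 0) 1) := by
      refine ⟨fun η => ?_⟩
      have := η.2
      rw [Subsingleton.elim (η : E 0) 0] at this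
      simp at this
    have hs : (Metric.closedBall (0 : E 0) 1)ᶜ = ∅ := by
      ext x
      simp [Subsingleton.elim x 0]
    have hz : (volume : Measure (E 0)).toSphere = 0 := Measure.eq_zero_of_isEmpty _
    rw [hs, hz]
    simp
  set H : E n → V := (Metric.closedBall 0 1)ᶜ.indicator h with hH
  have hmeas : MeasurableSet (Metric.closedBall (0 : E n) 1)ᶜ := measurableSet_closedBall.compl
  have hHi : Integrable H := (integrable_indicator_iff hmeas).2 hh
  have hmp := (volume : Measure (E n)).measurePreserving_homeomorphUnitSphereProd
  have hemb := (homeomorphUnitSphereProd (E n)).measurableEmbedding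
  have hdim : Module.finrank ℝ (E n) - 1 = n - 1 := by simp
  set g : Metric.sphere (0 : E n) 1 × Set.Ioi (0 : ℝ) → V := fun p => H (p.2.1 • p.1.1) with hg
  have hgH : ∀ x : ({0}ᶜ : Set (E n)), g (homeomorphUnitSphereProd (E n) x) = H x := by
    intro x
    have : ((homeomorphUnitSphereProd (E n)).symm
        (homeomorphUnitSphereProd (E n) x) : E n) = x := by
      rw [Homeomorph.symm_apply_apply]
    rw [homeomorphUnitSphereProd_symm_apply_coe] at this
    simp only [hg]
    rw [this]
  have hgi : Integrable g
      ((volume : Measure (E n)).toSphere.prod (Measure.volumeIoiPow (n - 1))) := by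
    rw [← hdim, ← hmp.integrable_comp_emb hemb]
    have h1 : IntegrableOn H {0}ᶜ := hHi.integrableOn
    rw [integrableOn_iff_comap_subtypeVal (measurableSet_singleton _).compl] at h1
    exact h1.congr (Eventually.of_forall fun x => (hgH x).symm)
  have hgint : ∫ ξ in (Metric.closedBall 0 1)ᶜ, h ξ =
      ∫ p, g p ∂((volume : Measure (E n)).toSphere.prod (Measure.volumeIoiPow (n - 1))) := by
    rw [← hdim, ← hmp.integral_comp hemb, ← integral_indicator hmeas]
    simp only [hgH]
    have : Nontrivial (E n) := by
      have : Nonempty (Fin n) := ⟨⟨0, hn⟩⟩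
      infer_instance
    rw [integral_subtype_comap (measurableSet_singleton _).compl H, restrict_compl_singleton]
  have hinner : ∀ η : Metric.sphere (0 : E n) 1,
      ∫ r, g (η, r) ∂(Measure.volumeIoiPow (n - 1)) =
        ∫ t in Set.Ioi (0 : ℝ), Real.exp t ^ n • h (Real.exp t • η) := by
    intro η
    have h1 := integral_volumeIoiPow (n - 1) fun r => H (r • (η : E n))
    simp only [hg]
    rw [h1]
    have hη : ‖(η : E n)‖ = 1 := by simp
    have h2 : ∀ r ∈ Set.Ioi (0 : ℝ), r ^ (n - 1) • H (r • (η : E n)) =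
        (Set.Ioi 1).indicator (fun r => r ^ (n - 1) • h (r • (η : E n))) r := by
      intro r hr
      have hr' : (0 : ℝ) < r := hr
      have hiff : r • (η : E n) ∈ (Metric.closedBall (0 : E n) 1)ᶜ ↔ r ∈ Set.Ioi (1 : ℝ) := by
        simp [norm_smul, hη, abs_of_pos hr']
      by_cases h3 : r ∈ Set.Ioi (1 : ℝ)
      · rw [Set.indicator_of_mem h3, hH, Set.indicator_of_mem (hiff.2 h3)]
      · rw [Set.indicator_of_notMem h3, hH, Set.indicator_of_notMem fun h4 => h3 (hiff.1 h4),
          smul_zero]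
    rw [setIntegral_congr_fun measurableSet_Ioi h2, setIntegral_indicator measurableSet_Ioi,
      Set.Ioi_inter_Ioi, sup_of_le_right zero_le_one, integral_Ioi_one_eq_integral_exp]
    refine setIntegral_congr_fun measurableSet_Ioi fun t _ => ?_
    simp only [smul_smul]
    -- The Jacobian `e^t` of `r = e^t` raises `r^{n-1}` to `e^{nt}`; the truncated `n - 1` is
    -- harmless since `n > 0`.
    rw [← pow_succ', Nat.sub_add_cancel hn]
  refine ⟨?_, ?_⟩
  · simpa only [hinner] using hgi.integral_prod_left
  · rw [hgint, integral_prod _ hgi]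
    simp only [hinner]

end Polar

/-- The substitution `s = Re w - t` gives the form in which polar coordinates produce the integral.
-/
theorem horizontalIntegral_eq {V : Type*} [NormedAddCommGroup V] [NormedSpace ℂ V] (q : ℂ → V)
    (w : ℂ) : horizontalIntegral q w = ∫ t in Set.Ioi (0 : ℝ), q (w - t) := by
  have h1 := (Measure.measurePreserving_sub_left (volume : Measure ℝ) w.re).setIntegral_preimage_emb
    (Homeomorph.subLeft w.re).measurableEmbedding (fun s : ℝ => q (s + w.im * Complex.I))
    (Set.Iic w.re)
  have h2 : (fun t : ℝ => w.re - t) ⁻¹' Set.Iic w.re = Set.Ici 0 := by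
    ext t
    simp
  rw [horizontalIntegral, ← h1, h2, integral_Ici_eq_integral_Ioi]
  congr 1
  ext t
  congr 1
  conv_rhs => rw [← Complex.re_add_im w]
  push_cast
  ring

end

/-! ### Error bounds with a logarithm, and homogeneous symbols in logarithmic coordinates. -/

section

section LogBound

variable {V : Type*} [NormedAddCommGroup V] {Γ : Sector} {s : ℝ} {R R' : ℂ → V}

/-- `R(w) = O((1 + Re w) e^{s Re w})`, uniformly in closed half strips. -/
def LogBound (Γ : Sector) (s : ℝ) (R : ℂ → V) : Prop :=
  ∀ a b, Γ.lo < a → b < Γ.hi → ∃ C : ℝ, ∀ w ∈ halfStrip a b,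
    ‖R w‖ ≤ C * ((1 + w.re) * Real.exp (s * w.re))

theorem LogBound.congr (h : LogBound Γ s R)
    (hR : ∀ w : ℂ, 0 ≤ w.re → w.im ∈ Set.Ioo Γ.lo Γ.hi → R w = R' w) : LogBound Γ s R' := by
  intro a b ha hb
  obtain ⟨C, hC⟩ := h a b ha hb
  refine ⟨C, fun w hw => ?_⟩
  rw [← hR w hw.1 (im_mem_Ioo ha hb hw)]
  exact hC w hw

theorem LogBound.add (h : LogBound Γ s R) (h' : LogBound Γ s R') :
    LogBound Γ s fun w => R w + R' w := by
  intro a b ha hb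
  obtain ⟨C, hC⟩ := h a b ha hb
  obtain ⟨C', hC'⟩ := h' a b ha hb
  refine ⟨C + C', fun w hw => (norm_add_le _ _).trans ?_⟩
  rw [add_mul]
  exact add_le_add (hC w hw) (hC' w hw)

theorem LogBound.neg (h : LogBound Γ s R) : LogBound Γ s fun w => -R w := by
  simpa only [LogBound, norm_neg] using h

theorem LogBound.sub (h : LogBound Γ s R) (h' : LogBound Γ s R') :
    LogBound Γ s fun w => R w - R' w := by
  simpa only [sub_eq_add_neg] using h.add h'.neg

theorem LogBound.zero : LogBound Γ s fun _ => (0 : V) := fun a b _ _ =>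
  ⟨0, fun w _ => by simp⟩

theorem LogBound.sum {ι : Type*} {t : Finset ι} {r : ι → ℂ → V}
    (h : ∀ i ∈ t, LogBound Γ s (r i)) : LogBound Γ s fun w => ∑ i ∈ t, r i w := by
  classical
  induction t using Finset.induction_on with
  | empty => simpa using LogBound.zero
  | insert i t hi ih =>
    simp only [Finset.sum_insert hi]
    exact (h i (Finset.mem_insert_self i t)).add
      (ih fun j hj => h j (Finset.mem_insert_of_mem hj))

theorem LogBound.mono {s' : ℝ} (h : LogBound Γ s R) (hs : s ≤ s') : LogBound Γ s' R := by
  intro a b ha hb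
  obtain ⟨C, hC⟩ := h a b ha hb
  refine ⟨|C|, fun w hw => (hC w hw).trans ?_⟩
  have h0 := hw.1
  exact mul_le_mul (le_abs_self C) (mul_le_mul_of_nonneg_left (Real.exp_le_exp.2
    (mul_le_mul_of_nonneg_right hs h0)) (by positivity)) (by positivity) (abs_nonneg C)

theorem LogBound.of_norm_le_exp
    (h : ∀ a b, Γ.lo < a → b < Γ.hi → ∃ C : ℝ, ∀ w ∈ halfStrip a b,
      ‖R w‖ ≤ C * Real.exp (s * w.re)) : LogBound Γ s R := by
  intro a b ha hb
  obtain ⟨C, hC⟩ := h a b ha hb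
  refine ⟨|C|, fun w hw => (hC w hw).trans ?_⟩
  have h0 := hw.1
  have h1 := Real.exp_pos (s * w.re)
  exact mul_le_mul (le_abs_self C) (le_mul_of_one_le_left h1.le (by linarith)) h1.le (abs_nonneg C)

variable [NormedSpace ℂ V]

theorem logBound_exp_smul (c : V) : LogBound Γ s fun w => Complex.exp (s * w) • c :=
  LogBound.of_norm_le_exp fun a b _ _ => ⟨‖c‖, fun w _ => by
    rw [norm_smul, norm_exp_real_mul, mul_comm]⟩

theorem norm_le_of_mem_halfStrip {a b : ℝ} {w : ℂ} (hw : w ∈ halfStrip a b) :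
    ‖w‖ ≤ (1 + |a| + |b|) * (1 + w.re) := by
  have h1 : |w.im| ≤ |a| + |b| := by
    rw [abs_le]
    constructor
    · linarith [hw.2.1, neg_abs_le a, abs_nonneg b]
    · linarith [hw.2.2, le_abs_self b, abs_nonneg a]
  refine (Complex.norm_le_abs_re_add_abs_im w).trans ?_
  rw [abs_of_nonneg hw.1]
  nlinarith [hw.1, abs_nonneg a, abs_nonneg b,
    mul_nonneg (add_nonneg (abs_nonneg a) (abs_nonneg b)) hw.1]

/-- In a half strip `|w|` is at most a multiple of `1 + Re w`; this is why that factor appears in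
`LogBound`. -/
theorem logBound_exp_smul_log (c c' : V) :
    LogBound Γ s fun w => Complex.exp (s * w) • (w • c + c') := by
  intro a b ha hb
  refine ⟨(1 + |a| + |b|) * ‖c‖ + ‖c'‖, fun w hw => ?_⟩
  rw [norm_smul, norm_exp_real_mul, mul_comm, ← mul_assoc]
  gcongr
  refine (norm_add_le _ _).trans ?_
  rw [norm_smul]
  have h1 := mul_le_mul_of_nonneg_right (norm_le_of_mem_halfStrip hw) (norm_nonneg c)
  nlinarith [mul_nonneg hw.1 (norm_nonneg c')]

end LogBound

section Homogeneous

variable {n : ℕ} {A : Type*} [CStarAlgebra A] {Γ : Sector}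

/-- The integrand of the radial integral of a homogeneous symbol, in logarithmic coordinates. -/
def radialFun (p : ℝ) (F : E n → ℂ → A) (ξ : E n) (w : ℂ) : A :=
  Complex.exp (-(p * w)) • F ξ (Complex.exp w)

/-- Homogeneity of degree `q` outside the unit ball. -/
def HomogeneousOutside (Γ : Sector) (q : ℝ) (F : E n → ℂ → A) : Prop :=
  ∀ (ξ : E n) (μ : ℂ) (t : ℝ), 1 ≤ ‖ξ‖ → μ ∈ Γ.carrier → 1 ≤ t →
    F (t • ξ) (t * μ) = (t ^ q : ℝ) • F ξ μ

/-- Homogeneity at the parameter `e^{w-t}`: a dilation of `ξ` becomes a translation of `w`. The real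
part of `w - t` may be negative, since homogeneity holds on all of `Γ`. -/
theorem HomogeneousOutside.exp_smul {q : ℝ} {F : E n → ℂ → A} (hF : HomogeneousOutside Γ q F)
    {ξ : E n} (hξ : 1 ≤ ‖ξ‖) {w : ℂ} (hw : w.im ∈ Set.Ioo Γ.lo Γ.hi) {t : ℝ} (ht : 0 ≤ t) :
    F (Real.exp t • ξ) (Complex.exp w) = Complex.exp (q * t) • F ξ (Complex.exp (w - t)) := by
  have h1 := hF ξ (Complex.exp (w - t)) (Real.exp t) hξ
    (Sector.exp_mem_carrier (by simpa using hw)) (Real.one_le_exp ht)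
  rw [Complex.ofReal_exp, ← Complex.exp_add, add_sub_cancel, ← Real.exp_mul] at h1
  rw [h1, ← Complex.coe_smul]
  congr 1
  rw [Complex.ofReal_exp]
  push_cast
  ring_nf

theorem IsParamSymbol.differentiableOn_radialFun {M d p : ℝ} {F : E n → ℂ → A}
    (hF : IsParamSymbol Γ M d F) (ξ : E n) :
    DifferentiableOn ℂ (radialFun p F ξ) (Complex.im ⁻¹' Set.Ioo Γ.lo Γ.hi) := by
  have h1 : DifferentiableOn ℂ (fun w => F ξ (Complex.exp w)) (Complex.im ⁻¹' Set.Ioo Γ.lo Γ.hi) :=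
    (hF.holomorphic ξ).comp Complex.differentiable_exp.differentiableOn
      fun w hw => Sector.exp_mem_carrier hw
  have h2 : Differentiable ℂ fun w : ℂ => Complex.exp (-(p * w)) := by fun_prop
  exact h2.differentiableOn.smul h1

/-- For `Re w ≤ 0`, homogeneity moves the parameter to the unit circle and `ξ` to radius `e^{-Re
w}`, where the symbol estimate of order `m` applies. For `m < -n` the bound decays at `-∞`; this is
where the hypothesis on `S^{m',d'}` enters. -/
theorem HomogeneousOutside.norm_radialFun_le {q m d : ℝ} {F : E n → ℂ → A}
    (hom : HomogeneousOutside Γ q F) (hF : IsParamSymbol Γ m d F) (hm : m ≤ 0)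
    {a b : ℝ} (ha : Γ.lo < a) (hb : b < Γ.hi) :
    ∃ D : ℝ, ∀ ξ : E n, ‖ξ‖ = 1 → ∀ w : ℂ, w.re ≤ 0 → w.im ∈ Set.Icc a b →
      ‖radialFun (q + n) F ξ w‖ ≤ D * Real.exp ((-n - m) * w.re) := by
  obtain ⟨C, hC0, hC⟩ := hF.norm_le ha hb
  refine ⟨C, fun ξ hξ w hw1 hw2 => ?_⟩
  have hmem : ((0 : ℝ) + w.im * Complex.I : ℂ) ∈ halfStrip a b := mk_mem_halfStrip le_rfl hw2
  have h1 := hC _ hmem (Real.exp (-w.re) • ξ)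
  rw [hom.exp_smul hξ.ge (im_mem_Ioo ha hb hmem) (neg_nonneg.2 hw1), norm_smul,
    norm_exp_real_mul] at h1
  have h2 : ((0 : ℝ) + w.im * Complex.I - (-w.re : ℝ) : ℂ) = w := by
    conv_rhs => rw [← Complex.re_add_im w]
    push_cast
    ring
  rw [h2] at h1
  -- As `m ≤ 0`, the lower bound `⟨ξ⟩ ≥ |ξ|` gives an upper bound for the power.
  have h3 : jb (Real.exp (-w.re) • ξ) ^ m ≤ Real.exp (-w.re * m) := by
    rw [Real.exp_mul]
    refine Real.rpow_le_rpow_of_nonpos (Real.exp_pos _) ?_ hm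
    refine le_trans (le_of_eq ?_) (norm_le_jb _)
    rw [norm_smul, hξ, mul_one, Real.norm_eq_abs, Real.abs_exp]
  have h4 : Real.exp (q * -w.re) * ‖F ξ (Complex.exp w)‖ ≤ C * Real.exp (-w.re * m) := by
    refine le_trans ?_ (h1.trans (mul_le_mul_of_nonneg_left h3 (by positivity)) |>.trans ?_)
    · simp
    · simp
  rw [radialFun, norm_smul, ← neg_mul, ← Complex.ofReal_neg, norm_exp_real_mul]
  have h5 : Real.exp (-(q + n) * w.re) = Real.exp (-n * w.re) * Real.exp (q * -w.re) := by
    rw [← Real.exp_add]; ring_nf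
  have h6 : Real.exp ((-n - m) * w.re) = Real.exp (-n * w.re) * Real.exp (-w.re * m) := by
    rw [← Real.exp_add]; ring_nf
  rw [h5, h6, mul_assoc, mul_left_comm C]
  exact mul_le_mul_of_nonneg_left h4 (Real.exp_pos _).le

/-- The factors `e^{nt}` from the Jacobian and `e^{qt}` from homogeneity combine to `e^{(q+n)w}
e^{-(q+n)(w-t)}`, so the radial integral is a horizontal integral ending at `w`. -/
theorem HomogeneousOutside.integral_compl_closedBall {q m d : ℝ} {F : E n → ℂ → A}
    (hom : HomogeneousOutside Γ q F) (hF : IsParamSymbol Γ m d F) (hm : m < -(n : ℝ))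
    {w : ℂ} (h0 : 0 ≤ w.re) (hw : w.im ∈ Set.Ioo Γ.lo Γ.hi) :
    Integrable (fun η : Metric.sphere (0 : E n) 1 =>
      horizontalIntegral (radialFun (q + n) F η) w) (volume : Measure (E n)).toSphere ∧
    ∫ ξ in (Metric.closedBall 0 1)ᶜ, F ξ (Complex.exp w) =
      Complex.exp ((q + n : ℝ) * w) • ∫ η : Metric.sphere (0 : E n) 1,
        horizontalIntegral (radialFun (q + n) F η) w ∂(volume : Measure (E n)).toSphere := by
  have hint := hF.integrable_of_integrable_jb (integrable_jb_rpow hm) h0 hw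
  obtain ⟨h1, h2⟩ := WeaklyParametric.integral_compl_closedBall hint.integrableOn
  have h3 : ∀ η : Metric.sphere (0 : E n) 1,
      ∫ t in Set.Ioi (0 : ℝ), Real.exp t ^ n • F (Real.exp t • (η : E n)) (Complex.exp w) =
        Complex.exp ((q + n : ℝ) * w) • horizontalIntegral (radialFun (q + n) F η) w := by
    intro η
    rw [horizontalIntegral_eq, ← integral_smul]
    refine setIntegral_congr_fun measurableSet_Ioi fun t ht => ?_
    beta_reduce
    rw [hom.exp_smul (by simp) hw (le_of_lt ht), radialFun, ← Complex.coe_smul, smul_smul,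
      smul_smul, ← Complex.exp_add, Complex.ofReal_pow, Complex.ofReal_exp, ← Complex.exp_nat_mul,
      ← Complex.exp_add]
    congr 2
    push_cast
    ring
  simp only [h3] at h1 h2
  refine ⟨?_, by rw [h2, integral_smul]⟩
  exact (integrable_fun_smul_iff (Complex.exp_ne_zero _) _).1 h1

end Homogeneous

end

/-! ### Expansion of the integral of one homogeneous term. -/

section

variable {n : ℕ} {A : Type*} [CStarAlgebra A] {Γ : Sector}

theorem jb_of_norm_eq_one {ξ : E n} (hξ : ‖ξ‖ = 1) : jb ξ = Real.sqrt 2 := by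
  rw [jb, hξ]
  norm_num

/-- The integral of the radial integrals over the sphere, minus the first `K` terms of its
expansion. -/
def radialRemainder (p d : ℝ) (F : E n → ℂ → A) (τ : ℕ → E n → A) (K : ℕ) (w : ℂ) : A :=
  (∫ η : Metric.sphere (0 : E n) 1, horizontalIntegral (radialFun p F η) w
      ∂(volume : Measure (E n)).toSphere) -
    ∑ k ∈ Finset.range K, expPrimitive (d - k - p) w •
      ∫ η : Metric.sphere (0 : E n) 1, τ k η ∂(volume : Measure (E n)).toSphere

theorem norm_radialFun_sub_le {F : E n → ℂ → A} {τ : ℕ → E n → A} {K : ℕ} {d p M C : ℝ}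
    {ξ : E n} {w : ℂ}
    (h : ‖Complex.exp (-(d * w)) • F ξ (Complex.exp w) -
      ∑ k ∈ Finset.range K, Complex.exp (-(k * w)) • τ k ξ‖ ≤
        C * jb ξ ^ (M + K) * Real.exp (-K * w.re)) :
    ‖radialFun p F ξ w - ∑ k ∈ Finset.range K, Complex.exp ((d - k - p : ℝ) * w) • τ k ξ‖ ≤
      C * jb ξ ^ (M + K) * Real.exp (-(-(d - K - p)) * w.re) := by
  have h1 : radialFun p F ξ w - ∑ k ∈ Finset.range K, Complex.exp ((d - k - p : ℝ) * w) • τ k ξ =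
      Complex.exp ((d - p : ℝ) * w) • (Complex.exp (-(d * w)) • F ξ (Complex.exp w) -
      ∑ k ∈ Finset.range K, Complex.exp (-(k * w)) • τ k ξ) := by
    rw [smul_sub, smul_smul, Finset.smul_sum, radialFun, ← Complex.exp_add]
    simp only [smul_smul, ← Complex.exp_add]
    congr 1
    · congr 2
      push_cast
      ring
    · refine Finset.sum_congr rfl fun k _ => ?_
      congr 2
      push_cast
      ring
  rw [h1, norm_smul, norm_exp_real_mul]
  refine (mul_le_mul_of_nonneg_left h (Real.exp_pos _).le).trans (le_of_eq ?_)
  rw [mul_left_comm, ← Real.exp_add]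
  ring_nf

theorem integrable_sphere {M : ℝ} {g : E n → A} (hg : StronglyMeasurable g)
    (hb : ∃ C : ℝ, 0 ≤ C ∧ ∀ ξ, ‖g ξ‖ ≤ C * jb ξ ^ M) :
    Integrable (fun η : Metric.sphere (0 : E n) 1 => g η) (volume : Measure (E n)).toSphere := by
  obtain ⟨C, -, hC⟩ := hb
  refine Integrable.of_bound (C := C * Real.sqrt 2 ^ M)
    (hg.comp_measurable measurable_subtype_coe).aestronglyMeasurable
    (Eventually.of_forall fun η => ?_)
  have := hC η
  rwa [jb_of_norm_eq_one (by simp)] at this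

section

variable {F : E n → ℂ → A} {q d m' d' : ℝ} {τ : ℕ → E n → A}

/-- The increment bounds are uniform over the sphere, where `⟨η⟩ = √2` makes the growth of the
Taylor data in `ξ` irrelevant, and the sphere has finite measure. -/
theorem radialRemainder_increments (hom : HomogeneousOutside Γ q F)
    (hF' : IsParamSymbol Γ m' d' F) (hm' : m' < -(n : ℝ))
    (hτm : ∀ k, StronglyMeasurable (τ k))
    (hτb : ∀ k, ∃ C : ℝ, 0 ≤ C ∧ ∀ ξ, ‖τ k ξ‖ ≤ C * jb ξ ^ (q - d + k))
    {a b : ℝ} (ha : Γ.lo < a) (hb : b < Γ.hi) {K : ℕ}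
    (hτ : ∃ C : ℝ, 0 ≤ C ∧ ∀ w ∈ halfStrip a b, ∀ ξ,
      ‖Complex.exp (-(d * w)) • F ξ (Complex.exp w) -
        ∑ k ∈ Finset.range K, Complex.exp (-(k * w)) • τ k ξ‖ ≤
          C * jb ξ ^ (q - d + K) * Real.exp (-K * w.re))
    (hK : 0 < -(d - K - (q + n))) :
    ∃ C : ℝ,
      (∀ w ∈ halfStrip a b, ∀ t : ℝ, 0 ≤ t →
        ‖radialRemainder (q + n) d F τ K (w + t) - radialRemainder (q + n) d F τ K w‖ ≤
          C * Real.exp (-(-(d - K - (q + n))) * w.re)) ∧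
      ∀ x : ℝ, 0 ≤ x → ∀ θ ∈ Set.Icc a b, ∀ θ' ∈ Set.Icc a b,
        ‖radialRemainder (q + n) d F τ K (x + θ * Complex.I) -
          radialRemainder (q + n) d F τ K (x + θ' * Complex.I)‖ ≤
            C * Real.exp (-(-(d - K - (q + n))) * x) := by
  have hn : (0 : ℝ) ≤ n := Nat.cast_nonneg n
  set p : ℝ := q + n with hp
  set α : ℝ := -(d - K - p) with hα
  set σ := (volume : Measure (E n)).toSphere with hσ
  obtain ⟨C, hC0, hC⟩ := hτ
  obtain ⟨D, hD⟩ := hom.norm_radialFun_le hF' (by linarith) ha hb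
  have hε : 0 < -(n : ℝ) - m' := by linarith
  set C₁ := C * Real.sqrt 2 ^ (q - d + K) with hC₁
  have hC₁0 : 0 ≤ C₁ := by positivity
  set P : E n → ℂ → A := fun ξ w => ∑ k ∈ Finset.range K, expPrimitive (d - k - p) w • τ k ξ with hP
  set P' : E n → ℂ → A := fun ξ w =>
    ∑ k ∈ Finset.range K, Complex.exp ((d - k - p : ℝ) * w) • τ k ξ with hP'
  have hPd : ∀ ξ w, HasDerivAt (P ξ) (P' ξ w) w := fun ξ w =>
    HasDerivAt.fun_sum fun k _ => (hasDerivAt_expPrimitive (d - k - p) w).smul_const (τ k ξ)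
  have hPc : ∀ ξ, Continuous (P' ξ) := fun ξ => by
    simp only [hP']
    fun_prop
  have hdiff : ∀ ξ, DifferentiableOn ℂ (radialFun p F ξ) (Complex.im ⁻¹' Set.Icc a b) := fun ξ =>
    (hF'.differentiableOn_radialFun ξ).mono fun w hw => ⟨ha.trans_le hw.1, hw.2.trans_lt hb⟩
  have hsub : ∀ η : Metric.sphere (0 : E n) 1, ∀ w ∈ halfStrip a b,
      ‖radialFun p F η w - P' η w‖ ≤ C₁ * Real.exp (-α * w.re) := by
    intro η w hw
    have := norm_radialFun_sub_le (p := p) (hC w hw η)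
    rwa [jb_of_norm_eq_one (by simp)] at this
  have hint : ∀ w ∈ halfStrip a b, Integrable (fun η : Metric.sphere (0 : E n) 1 =>
      horizontalIntegral (radialFun p F η) w - P η w) σ ∧ radialRemainder p d F τ K w =
      ∫ η : Metric.sphere (0 : E n) 1, (horizontalIntegral (radialFun p F η) w - P η w) ∂σ := by
    intro w hw
    have h1 := (hom.integral_compl_closedBall hF' hm' hw.1 (im_mem_Ioo ha hb hw)).1
    have h2 : ∀ k ∈ Finset.range K, Integrable (fun η : Metric.sphere (0 : E n) 1 =>
        expPrimitive (d - k - p) w • τ k η) σ := fun k _ =>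
      (integrable_sphere (hτm k) (hτb k)).smul (expPrimitive (d - k - p) w)
    refine ⟨h1.sub (integrable_finsetSum _ h2), ?_⟩
    rw [integral_sub h1 (integrable_finsetSum _ h2), integral_finsetSum _ h2]
    simp only [integral_smul]
    rfl
  refine ⟨(C₁ / α + C₁ * |b - a|) * σ.real Set.univ, fun w hw t ht => ?_,
    fun x hx θ hθ θ' hθ' => ?_⟩
  · have h1 := hint w hw
    have h2 := hint _ (halfStrip_add hw ht)
    rw [h1.2, h2.2, ← integral_sub h2.1 h1.1]
    refine (norm_integral_le_of_norm_le_const (C := C₁ / α * Real.exp (-α * w.re))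
      (Eventually.of_forall fun η => ?_)).trans ?_
    · exact norm_horizontal_increment_le (hdiff η) hε (hD η (by simp)) (hPd η) (hPc η) hK
        (hsub η) hw ht
    · rw [mul_right_comm]
      gcongr
      nlinarith [mul_nonneg hC₁0 (abs_nonneg (b - a))]
  · have h1 := hint _ (mk_mem_halfStrip hx hθ)
    have h2 := hint _ (mk_mem_halfStrip hx hθ')
    rw [h1.2, h2.2, ← integral_sub h1.1 h2.1]
    refine (norm_integral_le_of_norm_le_const (C := C₁ * (b - a) * Real.exp (-α * x))
      (Eventually.of_forall fun η => ?_)).trans ?_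
    · exact norm_vertical_increment_le (hdiff η) hε (hD η (by simp)) (hPd η) (hPc η)
        (hsub η) hx hθ' hθ
    · rw [mul_right_comm]
      gcongr
      have h3 : 0 ≤ C₁ / α := by positivity
      nlinarith [mul_le_mul_of_nonneg_left (le_abs_self (b - a)) hC₁0]

theorem tendsto_expPrimitive {s : ℝ} (hs : s < 0) (θ : ℝ) :
    Tendsto (fun t : ℝ => expPrimitive s (t + θ * Complex.I)) atTop (𝓝 0) := by
  rw [tendsto_zero_iff_norm_tendsto_zero]
  have h1 := (tendsto_exp_neg_mul_atTop (α := -s) (by linarith)).div_const |s|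
  rw [zero_div] at h1
  refine h1.congr fun t => ?_
  rw [expPrimitive, if_neg hs.ne, norm_div, norm_exp_real_mul]
  simp

/-- Once `K > d - (q + n)`, the remainder has decaying increments and converges. Terms subtracted
beyond that point tend to `0`, so the limit `c`, the integration constant, does not depend on `K`.
-/
theorem exists_radialRemainder_bound (hom : HomogeneousOutside Γ q F)
    (hF' : IsParamSymbol Γ m' d' F) (hm' : m' < -(n : ℝ))
    (hτm : ∀ k, StronglyMeasurable (τ k))
    (hτb : ∀ k, ∃ C : ℝ, 0 ≤ C ∧ ∀ ξ, ‖τ k ξ‖ ≤ C * jb ξ ^ (q - d + k))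
    (hτ : ∀ (a b : ℝ), Γ.lo < a → b < Γ.hi → ∀ K : ℕ, ∃ C : ℝ, 0 ≤ C ∧ ∀ w ∈ halfStrip a b, ∀ ξ,
      ‖Complex.exp (-(d * w)) • F ξ (Complex.exp w) -
        ∑ k ∈ Finset.range K, Complex.exp (-(k * w)) • τ k ξ‖ ≤
          C * jb ξ ^ (q - d + K) * Real.exp (-K * w.re)) :
    ∃ (c : A) (K₀ : ℕ), ∀ K ≥ K₀, ∀ a b, Γ.lo < a → b < Γ.hi → ∃ C : ℝ, ∀ w ∈ halfStrip a b,
      ‖radialRemainder (q + n) d F τ K w - c‖ ≤ C * Real.exp ((d - K - (q + n)) * w.re) := by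
  obtain ⟨K₀, hK₀⟩ := exists_nat_gt (d - (q + n))
  have hpos : ∀ K ≥ K₀, 0 < -(d - (K : ℝ) - (q + n)) := fun K hK => by
    have : (K₀ : ℝ) ≤ K := by exact_mod_cast hK
    linarith
  obtain ⟨c, hc⟩ := exists_common_limit Γ.lo_lt_hi (hpos K₀ le_rfl) fun a b ha hb =>
    radialRemainder_increments hom hF' hm' hτm hτb ha hb (hτ a b ha hb K₀) (hpos K₀ le_rfl)
  have hcK : ∀ K ≥ K₀, ∀ θ ∈ Set.Ioo Γ.lo Γ.hi, Tendsto
      (fun t : ℝ => radialRemainder (q + n) d F τ K (t + θ * Complex.I)) atTop (𝓝 c) := by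
    intro K hK θ hθ
    induction K, hK using Nat.le_induction with
    | base => exact hc θ hθ
    | succ K hK ih =>
      have h1 := ih.sub ((tendsto_expPrimitive (neg_pos.1 (hpos K hK)) θ).smul_const
        (∫ η : Metric.sphere (0 : E n) 1, τ K η ∂(volume : Measure (E n)).toSphere))
      rw [zero_smul, sub_zero] at h1
      refine h1.congr fun t => ?_
      rw [radialRemainder, radialRemainder, Finset.sum_range_succ]
      abel
  refine ⟨c, K₀, fun K hK a b ha hb => ?_⟩
  obtain ⟨C, hC, -⟩ := radialRemainder_increments hom hF' hm' hτm hτb ha hb (hτ a b ha hb K)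
    (hpos K hK)
  refine ⟨C, fun w hw => ?_⟩
  have := norm_sub_le_of_tendsto (hcK K hK w.im (im_mem_Ioo ha hb hw)) (hC w hw)
  rwa [neg_neg] at this

/-- The integral of a homogeneous symbol has an expansion with one global term. -/
theorem HomogeneousOutside.integral_expansion (hom : HomogeneousOutside Γ q F)
    (hF : IsParamSymbol Γ (q - d) d F) (hF' : IsParamSymbol Γ m' d' F) (hm' : m' < -(n : ℝ)) :
    ∃ (c : A) (c' c'' : ℕ → A), ∀ L : ℕ, LogBound Γ (d - L) fun w =>
      (∫ ξ, F ξ (Complex.exp w)) - Complex.exp ((q + n : ℝ) * w) • c -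
        ∑ k ∈ Finset.range L, Complex.exp ((d - k : ℝ) * w) • (w • c' k + c'' k) := by
  obtain ⟨τ, hτm, hτb, hτ⟩ := hF.exists_taylor
  obtain ⟨c, K₀, hc⟩ := exists_radialRemainder_bound hom hF' hm' hτm hτb hτ
  set p : ℝ := q + n with hp
  set g : ℕ → A := fun k => ∫ η : Metric.sphere (0 : E n) 1, τ k η
    ∂(volume : Measure (E n)).toSphere with hg
  set e : ℕ → A := fun k => ∫ ξ in Metric.closedBall 0 1, τ k ξ with he
  -- Resonance: a logarithm arises only if `d - k = q + n`, when the primitive of the constant `1`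
  -- is `w`. The terms `e k` come from the unit ball.
  set c' : ℕ → A := fun k => if d - k - p = 0 then g k else 0 with hc'
  set c'' : ℕ → A := fun k =>
    (if d - k - p = 0 then 0 else ((d - k - p : ℝ) : ℂ)⁻¹ • g k) + e k with hc''
  have hterm : ∀ (k : ℕ) (w : ℂ), Complex.exp ((d - k : ℝ) * w) • (w • c' k + c'' k) =
      Complex.exp (p * w) • (expPrimitive (d - k - p) w • g k) +
        Complex.exp ((d - k : ℝ) * w) • e k := by
    intro k w
    simp only [hc', hc'', expPrimitive]
    split_ifs with h
    · have : d - k = p := by linarith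
      rw [this, zero_add, smul_add]
    · rw [smul_zero, zero_add, smul_add]
      congr 1
      rw [smul_smul, smul_smul, mul_div_assoc', ← Complex.exp_add, div_eq_mul_inv]
      congr 3
      push_cast
      ring
  have hball : ∀ s : ℝ, IntegrableOn (fun ξ : E n => jb ξ ^ s) (Metric.closedBall 0 1) := fun s =>
    (continuous_jb_rpow s).continuousOn.integrableOn_compact (isCompact_closedBall 0 1)
  have hlarge : ∀ K ≥ K₀, LogBound Γ (d - K) fun w =>
      (∫ ξ, F ξ (Complex.exp w)) - Complex.exp (p * w) • c -
        ∑ k ∈ Finset.range K, Complex.exp ((d - k : ℝ) * w) • (w • c' k + c'' k) := by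
    intro K hK
    have h1 : LogBound Γ (d - K) fun w => (∫ ξ in Metric.closedBall 0 1, F ξ (Complex.exp w)) -
        ∑ k ∈ Finset.range K, Complex.exp ((d - k : ℝ) * w) • e k := by
      refine LogBound.of_norm_le_exp fun a b ha hb => ?_
      push_cast
      exact hF.integral_expansion hτm hτb ha hb (hτ a b ha hb K) fun k _ => hball _
    have h2 : LogBound Γ (d - K) fun w => Complex.exp (p * w) •
        (radialRemainder p d F τ K w - c) := by
      refine LogBound.of_norm_le_exp fun a b ha hb => ?_
      obtain ⟨C, hC⟩ := hc K hK a b ha hb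
      refine ⟨C, fun w hw => ?_⟩
      rw [norm_smul, norm_exp_real_mul]
      refine (mul_le_mul_of_nonneg_left (hC w hw) (Real.exp_pos _).le).trans (le_of_eq ?_)
      rw [mul_left_comm, ← Real.exp_add]
      ring_nf
    refine (h1.add h2).congr fun w h0 hw => ?_
    have hint := hF'.integrable_of_integrable_jb (integrable_jb_rpow hm') h0 hw
    have h3 := (hom.integral_compl_closedBall hF' hm' h0 hw).2
    rw [← hp] at h3
    rw [← integral_add_compl measurableSet_closedBall hint, h3]
    simp only [hterm, hg, radialRemainder, Finset.sum_add_distrib, smul_sub, Finset.smul_sum]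
    abel
  refine ⟨c, c', c'', fun L => ?_⟩
  -- For small `L` the expansion is taken to order `max L K₀` and the surplus terms are moved into
  -- the error.
  have h1 := (hlarge (max L K₀) (le_max_right _ _)).mono (s' := d - L) (by
    have : (L : ℝ) ≤ (max L K₀ : ℕ) := by exact_mod_cast le_max_left L K₀
    linarith)
  have h2 : LogBound Γ (d - L) fun w => ∑ k ∈ Finset.Ico L (max L K₀),
      Complex.exp ((d - k : ℝ) * w) • (w • c' k + c'' k) :=
    LogBound.sum fun k hk => (logBound_exp_smul_log _ _).mono (by
      have : (L : ℝ) ≤ k := by exact_mod_cast (Finset.mem_Ico.1 hk).1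
      linarith)
  refine (h1.add h2).congr fun w _ _ => ?_
  rw [← Finset.sum_range_add_sum_Ico _ (le_max_left L K₀)]
  abel

end

end

/-! ### Uniqueness and compatibility of coefficients. -/

section

section Coefficients

variable {V : Type*} [NormedAddCommGroup V] [NormedSpace ℂ V] {Γ : Sector}

/-- After division by `e^{sw}`, `w • x + y` tends to `0` along a ray; its difference under `t ↦ t +
1` is the constant `x`. -/
theorem eq_zero_of_logBound_exp_smul_log {s : ℝ} {x y : V}
    (h : LogBound Γ (s - 1) fun w => Complex.exp (s * w) • (w • x + y)) : x = 0 ∧ y = 0 := by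
  set θ := (Γ.lo + Γ.hi) / 2 with hθ
  have h0 := Γ.lo_lt_hi
  obtain ⟨C, hC⟩ := h θ θ (by rw [hθ]; linarith) (by rw [hθ]; linarith)
  have hlim : Tendsto (fun t : ℝ => (t + θ * Complex.I : ℂ) • x + y) atTop (𝓝 0) := by
    have h1 : Tendsto (fun t : ℝ => C * ((1 + t) * Real.exp (-t))) atTop (𝓝 0) := by
      have h2 := (Real.tendsto_pow_mul_exp_neg_atTop_nhds_zero 1).add
        (Real.tendsto_pow_mul_exp_neg_atTop_nhds_zero 0)
      have h3 := h2.const_mul C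
      rw [add_zero, mul_zero] at h3
      refine h3.congr fun t => ?_
      ring
    refine squeeze_zero_norm' ?_ h1
    filter_upwards [eventually_ge_atTop 0] with t ht
    have h2 := hC _ (mk_mem_halfStrip ht (Set.left_mem_Icc.2 le_rfl))
    rw [norm_smul, norm_exp_real_mul] at h2
    have h3 : (t + θ * Complex.I : ℂ).re = t := by simp
    rw [h3] at h2
    have h4 : Real.exp ((s - 1) * t) = Real.exp (s * t) * Real.exp (-t) := by
      rw [← Real.exp_add]; ring_nf
    refine le_of_mul_le_mul_left (h2.trans (le_of_eq ?_)) (Real.exp_pos (s * t))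
    rw [h4]
    ring
  have hx : x = 0 := by
    have h1 := (hlim.comp (tendsto_atTop_add_const_right atTop (1 : ℝ) tendsto_id)).sub hlim
    rw [sub_zero] at h1
    refine tendsto_nhds_unique (tendsto_const_nhds.congr fun t => ?_) h1
    simp only [Function.comp, id, add_sub_add_right_eq_sub, ← sub_smul]
    push_cast
    ring_nf
    rw [one_smul]
  refine ⟨hx, ?_⟩
  simp only [hx, smul_zero, zero_add] at hlim
  exact tendsto_nhds_unique tendsto_const_nhds hlim

/-- Strong induction from the leading exponent: once the earlier terms vanish, the later ones are
one order smaller and join the error. -/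
theorem eq_zero_of_logBound_sum {d : ℝ} {x y : ℕ → V} {L : ℕ}
    (h : LogBound Γ (d - L) fun w =>
      ∑ k ∈ Finset.range L, Complex.exp ((d - k : ℝ) * w) • (w • x k + y k)) :
    ∀ k < L, x k = 0 ∧ y k = 0 := by
  intro k
  induction k using Nat.strong_induction_on with
  | _ k ih =>
    intro hk
    refine eq_zero_of_logBound_exp_smul_log (Γ := Γ) (s := d - k) ?_
    have hkL : ((k : ℝ) + 1) ≤ L := by exact_mod_cast hk
    have h1 := h.mono (s' := d - k - 1) (by linarith)
    have h2 : LogBound Γ (d - k - 1) fun w => ∑ j ∈ Finset.Ico (k + 1) L,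
        Complex.exp ((d - j : ℝ) * w) • (w • x j + y j) :=
      LogBound.sum fun j hj => (logBound_exp_smul_log _ _).mono (by
        have : ((k : ℝ) + 1) ≤ j := by exact_mod_cast (Finset.mem_Ico.1 hj).1
        linarith)
    refine (h1.sub h2).congr fun w _ _ => ?_
    rw [← Finset.sum_range_add_sum_Ico _ (Nat.succ_le_of_lt hk), add_sub_cancel_right,
      Finset.sum_range_succ, Finset.sum_eq_zero, zero_add]
    intro j hj
    have hj' := Finset.mem_range.1 hj
    rw [(ih j hj' (hj'.trans hk)).1, (ih j hj' (hj'.trans hk)).2]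
    simp

/-- Expansions of all orders with the same coefficients `c` fit together. -/
theorem exists_coefficients {p d : ℝ} {G : ℂ → V} {c : ℕ → V} {N : ℕ → ℕ} (hmono : Monotone N)
    (hN : ∀ L, p - N L ≤ d - L)
    (h : ∀ L : ℕ, ∃ c' c'' : ℕ → V, LogBound Γ (d - L) fun w =>
      G w - ∑ j ∈ Finset.range (N L), Complex.exp ((p - j : ℝ) * w) • c j -
        ∑ k ∈ Finset.range L, Complex.exp ((d - k : ℝ) * w) • (w • c' k + c'' k)) :
    ∃ c' c'' : ℕ → V, ∀ L : ℕ, LogBound Γ (d - L) fun w =>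
      G w - ∑ j ∈ Finset.range (N L), Complex.exp ((p - j : ℝ) * w) • c j -
        ∑ k ∈ Finset.range L, Complex.exp ((d - k : ℝ) * w) • (w • c' k + c'' k) := by
  choose x y hxy using h
  have key : ∀ L L' : ℕ, L ≤ L' → ∀ k < L, x L k = x L' k ∧ y L k = y L' k := by
    intro L L' hL k hk
    have hLr : (L : ℝ) ≤ L' := by exact_mod_cast hL
    have h1 := (hxy L').mono (s' := d - L) (by linarith)
    -- The extra powers in the longer expansion are negligible because `p - N L ≤ d - L`.
    have h2 : LogBound Γ (d - L) fun w => ∑ j ∈ Finset.Ico (N L) (N L'),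
        Complex.exp ((p - j : ℝ) * w) • c j :=
      LogBound.sum fun j hj => (logBound_exp_smul _).mono (by
        have : (N L : ℝ) ≤ j := by exact_mod_cast (Finset.mem_Ico.1 hj).1
        linarith [hN L])
    have h3 : LogBound Γ (d - L) fun w => ∑ k ∈ Finset.Ico L L',
        Complex.exp ((d - k : ℝ) * w) • (w • x L' k + y L' k) :=
      LogBound.sum fun k hk => (logBound_exp_smul_log _ _).mono (by
        have : (L : ℝ) ≤ k := by exact_mod_cast (Finset.mem_Ico.1 hk).1
        linarith)
    have h4 := eq_zero_of_logBound_sum (x := fun k => x L k - x L' k)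
      (y := fun k => y L k - y L' k)
      ((((h1.sub (hxy L)).add h2).add h3).congr fun w _ _ => ?_) k hk
    · exact ⟨sub_eq_zero.1 h4.1, sub_eq_zero.1 h4.2⟩
    · rw [← Finset.sum_range_add_sum_Ico _ (hmono hL), ← Finset.sum_range_add_sum_Ico _ hL]
      have h5 : ∑ k ∈ Finset.range L, Complex.exp ((d - k : ℝ) * w) •
          (w • (x L k - x L' k) + (y L k - y L' k)) =
          ∑ k ∈ Finset.range L, Complex.exp ((d - k : ℝ) * w) • (w • x L k + y L k) -
          ∑ k ∈ Finset.range L, Complex.exp ((d - k : ℝ) * w) • (w • x L' k + y L' k) := by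
        rw [← Finset.sum_sub_distrib]
        refine Finset.sum_congr rfl fun k _ => ?_
        rw [← smul_sub, smul_sub w]
        congr 1
        abel
      rw [h5]
      generalize ∑ k ∈ Finset.range L, Complex.exp ((d - k : ℝ) * w) • (w • x L k + y L k) = s₁
      generalize ∑ k ∈ Finset.range L, Complex.exp ((d - k : ℝ) * w) • (w • x L' k + y L' k) = s₂
      abel
  -- Order `k + 1` is the first expansion that contains the `k`-th coefficient.
  refine ⟨fun k => x (k + 1) k, fun k => y (k + 1) k, fun L => (hxy L).congr fun w _ _ => ?_⟩
  congr 1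
  refine Finset.sum_congr rfl fun k hk => ?_
  have h1 := key (k + 1) L (Finset.mem_range.1 hk) k k.lt_succ_self
  beta_reduce
  rw [h1.1, h1.2]

end Coefficients

/-! ### Assembly of the full expansion and passage to the trace. -/

variable {n : ℕ} {A : Type*} [CStarAlgebra A] {Γ : Sector}

/-- At this low order all Taylor coefficients used are integrable over `ℝⁿ`, so no logarithms or
global terms arise. -/
theorem IsParamSymbol.exists_integral_expansion {M d : ℝ} {r : E n → ℂ → A}
    (hr : IsParamSymbol Γ M d r) {L : ℕ} (hL : M + L < -(n : ℝ)) :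
    ∃ e : ℕ → A, LogBound Γ (d - L) fun w => (∫ ξ, r ξ (Complex.exp w)) -
      ∑ k ∈ Finset.range L, Complex.exp ((d - k : ℝ) * w) • e k := by
  obtain ⟨τ, hτm, hτb, hτ⟩ := hr.exists_taylor
  refine ⟨fun k => ∫ ξ, τ k ξ, LogBound.of_norm_le_exp fun a b ha hb => ?_⟩
  push_cast
  exact hr.integral_expansion hτm hτb ha hb (hτ a b ha hb L) fun k hk => integrable_jb_rpow (by
    have : (k : ℝ) ≤ L := by exact_mod_cast hk
    linarith)

theorem IsWeaklyPolyhomogeneous.exists_integral_expansion {S : TwistedSystem n A} {m d : ℝ}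
    {f : E n → ℂ → A} {F : ℕ → E n → ℂ → A} (hf : IsWeaklyPolyhomogeneous S Γ m d f F)
    {m' d' : ℝ} (hm' : m' < -(n : ℝ)) (hf' : IsWeakSymbol S Γ m' d' f)
    (hF' : ∀ j : ℕ, -(n : ℝ) ≤ m - j - d → IsWeakSymbol S Γ m' d' (F j)) :
    ∃ c c' c'' : ℕ → A, ∀ L : ℕ, LogBound Γ (d - L) fun w => (∫ ξ, f ξ (Complex.exp w)) -
      ∑ j ∈ Finset.range (L + (⌈m + n - d⌉₊ + 1)), Complex.exp ((m + n - j : ℝ) * w) • c j -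
        ∑ k ∈ Finset.range L, Complex.exp ((d - k : ℝ) * w) • (w • c' k + c'' k) := by
  have hF0 : ∀ j, ∃ m₀ d₀ : ℝ, m₀ < -(n : ℝ) ∧ IsParamSymbol Γ m₀ d₀ (F j) := by
    intro j
    by_cases hj : -(n : ℝ) ≤ m - j - d
    · exact ⟨m', d', hm', (hF' j hj).isParamSymbol⟩
    -- For the remaining `j` the term's own order is already below `-n`.
    · exact ⟨m - j - d, d, not_le.1 hj, (hf.term_mem j).isParamSymbol⟩
  have hex : ∀ j, ∃ (c : A) (c' c'' : ℕ → A), ∀ L : ℕ, LogBound Γ (d - L) fun w =>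
      (∫ ξ, F j ξ (Complex.exp w)) - Complex.exp ((m - j + n : ℝ) * w) • c -
        ∑ k ∈ Finset.range L, Complex.exp ((d - k : ℝ) * w) • (w • c' k + c'' k) := by
    intro j
    obtain ⟨m₀, d₀, hm₀, h₀⟩ := hF0 j
    exact HomogeneousOutside.integral_expansion (hf.homogeneous j) (hf.term_mem j).isParamSymbol
      h₀ hm₀
  choose c x y hxy using hex
  have hceil := Nat.le_ceil (m + n - d)
  refine ⟨c, exists_coefficients (N := fun L => L + (⌈m + n - d⌉₊ + 1))
    (fun L L' hL => Nat.add_le_add_right hL _) (fun L => by push_cast; linarith) fun L => ?_⟩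
  -- This `N` gives the remainder an order `m - d - N` with `m - d - N + L < -n`, and makes the
  -- first omitted global power at most `d - L`.
  set N := L + (⌈m + n - d⌉₊ + 1) with hN
  obtain ⟨e, he⟩ := (hf.remainder N).isParamSymbol.exists_integral_expansion (L := L) (by
    rw [hN]; push_cast; linarith)
  refine ⟨fun k => ∑ j ∈ Finset.range N, x j k, fun k => ∑ j ∈ Finset.range N, y j k + e k, ?_⟩
  have hsum := LogBound.sum (t := Finset.range N) fun j _ => hxy j L
  refine (hsum.add he).congr fun w h0 hw => ?_
  have hfi := hf'.isParamSymbol.integrable_of_integrable_jb (integrable_jb_rpow hm') h0 hw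
  have hFi : ∀ j ∈ Finset.range N, Integrable fun ξ => F j ξ (Complex.exp w) := by
    intro j _
    obtain ⟨m₀, d₀, hm₀, h₀⟩ := hF0 j
    exact h₀.integrable_of_integrable_jb (integrable_jb_rpow hm₀) h0 hw
  rw [integral_sub hfi (integrable_finsetSum _ hFi), integral_finsetSum _ hFi]
  simp only [Finset.sum_sub_distrib]
  rw [Finset.sum_comm (s := Finset.range N)]
  have h1 : ∑ k ∈ Finset.range L, Complex.exp ((d - k : ℝ) * w) •
      (w • ∑ j ∈ Finset.range N, x j k + (∑ j ∈ Finset.range N, y j k + e k)) =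
      ∑ k ∈ Finset.range L, ∑ j ∈ Finset.range N,
        Complex.exp ((d - k : ℝ) * w) • (w • x j k + y j k) +
      ∑ k ∈ Finset.range L, Complex.exp ((d - k : ℝ) * w) • e k := by
    rw [← Finset.sum_add_distrib]
    refine Finset.sum_congr rfl fun k _ => ?_
    rw [← Finset.smul_sum, Finset.sum_add_distrib, ← Finset.smul_sum, ← smul_add, add_assoc]
  have h2 : ∑ j ∈ Finset.range N, Complex.exp ((m - j + n : ℝ) * w) • c j =
      ∑ j ∈ Finset.range N, Complex.exp ((m + n - j : ℝ) * w) • c j :=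
    Finset.sum_congr rfl fun j _ => by rw [sub_add_eq_add_sub]
  rw [h1, h2]
  generalize ∑ k ∈ Finset.range L, ∑ j ∈ Finset.range N,
        Complex.exp ((d - k : ℝ) * w) • (w • x j k + y j k) = s₁
  generalize ∑ k ∈ Finset.range L, Complex.exp ((d - k : ℝ) * w) • e k = s₂
  generalize ∑ j ∈ Finset.range N, Complex.exp ((m + n - j : ℝ) * w) • c j = s₃
  abel

/-- The case `j = 0` of the symbol condition, divided by the nonzero constant `z^d`. -/
theorem IsWeakSymbol.isSymbol {S : TwistedSystem n A} {m d : ℝ} {f : E n → ℂ → A}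
    (hf : IsWeakSymbol S Γ m d f) {μ : ℂ} (hμ : μ ∈ Γ.carrier) :
    S.IsSymbol m fun ξ => f ξ μ := by
  have h1 := hf.symbol 0 μ⁻¹ (by rwa [inv_inv])
  have hne : Γ.pow μ (-d) ≠ 0 := Complex.exp_ne_zero _
  have h2 := h1.const_smul (inv_ne_zero hne)
  simp only [zDeriv, iteratedDeriv_zero, inv_inv, Nat.cast_zero, add_zero] at h2
  simpa only [smul_smul, inv_mul_cancel₀ hne, one_smul] using h2

theorem hasLogExpansion_of_logBound {p d : ℝ} {H : ℂ → A} {G : ℂ → ℂ} (φ : A →L[ℂ] ℂ)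
    (hG : ∀ μ ∈ Γ.carrier, G μ = φ (H μ)) {c c' c'' : ℕ → A} {s : ℕ}
    (h : ∀ L : ℕ, LogBound Γ (d - L) fun w => H (Complex.exp w) -
      ∑ j ∈ Finset.range (L + s), Complex.exp ((p - j : ℝ) * w) • c j -
        ∑ k ∈ Finset.range L, Complex.exp ((d - k : ℝ) * w) • (w • c' k + c'' k)) :
    HasLogExpansion Γ p d G (fun j => φ (c j)) (fun k => φ (c' k)) (fun k => φ (c'' k)) := by
  intro a b ha hb J K
  -- A single order `L` covers both truncations. The surplus logarithmic terms are `O((1 +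
  -- log|μ|)|μ|^{d-K})`, the surplus pure powers `O(|μ|^{p-J})`.
  set L := max J K with hL
  have hJL : J ≤ L + s := (le_max_left J K).trans (Nat.le_add_right _ _)
  have hKL : K ≤ L := le_max_right J K
  have h1 := (h L).mono (s' := d - K) (by
    have : (K : ℝ) ≤ L := by exact_mod_cast hKL
    linarith)
  have h2 : LogBound Γ (d - K) fun w => ∑ k ∈ Finset.Ico K L,
      Complex.exp ((d - k : ℝ) * w) • (w • c' k + c'' k) :=
    LogBound.sum fun k hk => (logBound_exp_smul_log _ _).mono (by
      have : (K : ℝ) ≤ k := by exact_mod_cast (Finset.mem_Ico.1 hk).1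
      linarith)
  obtain ⟨C, hC⟩ := (h1.add h2) a b ha hb
  set B := ∑ j ∈ Finset.Ico J (L + s), ‖c j‖ with hB
  refine ⟨‖φ‖ * (|C| + B), fun μ hμ hμ1 => ?_⟩
  obtain ⟨w, hw, rfl⟩ := Sector.exists_exp_of_mem_closedSector hμ hμ1
  have hwi := im_mem_Ioo ha hb hw
  have h0 := hw.1
  have hnorm : ∀ t : ℝ, ‖Complex.exp w‖ ^ t = Real.exp (t * w.re) := fun t => by
    rw [Complex.norm_exp, ← Real.exp_mul, mul_comm]
  have hlog : Real.log ‖Complex.exp w‖ = w.re := by rw [Complex.norm_exp, Real.log_exp]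
  rw [hnorm, hnorm, hlog, hG _ (Sector.exp_mem_carrier hwi)]
  simp only [Sector.pow_exp hwi, Sector.log_exp hwi]
  have h3 : ‖∑ j ∈ Finset.Ico J (L + s), Complex.exp ((p - j : ℝ) * w) • c j‖ ≤
      B * Real.exp ((p - J) * w.re) := by
    rw [hB, Finset.sum_mul]
    refine norm_sum_le_of_le _ fun j hj => ?_
    rw [norm_smul, norm_exp_real_mul, mul_comm]
    have : (J : ℝ) ≤ j := by exact_mod_cast (Finset.mem_Ico.1 hj).1
    gcongr
  have h4 := hC w hw
  have h5 : φ (H (Complex.exp w)) -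
      ∑ j ∈ Finset.range J, φ (c j) * Complex.exp ((p - j : ℝ) * w) -
      ∑ k ∈ Finset.range K, (φ (c' k) * w + φ (c'' k)) * Complex.exp ((d - k : ℝ) * w) =
      φ ((H (Complex.exp w) -
        ∑ j ∈ Finset.range (L + s), Complex.exp ((p - j : ℝ) * w) • c j -
        ∑ k ∈ Finset.range L, Complex.exp ((d - k : ℝ) * w) • (w • c' k + c'' k) +
        ∑ k ∈ Finset.Ico K L, Complex.exp ((d - k : ℝ) * w) • (w • c' k + c'' k)) +
        ∑ j ∈ Finset.Ico J (L + s), Complex.exp ((p - j : ℝ) * w) • c j) := by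
    rw [← Finset.sum_range_add_sum_Ico _ hJL, ← Finset.sum_range_add_sum_Ico _ hKL]
    simp only [map_add, map_sub, map_sum, map_smul, smul_eq_mul, mul_comm (φ _)]
    simp only [mul_comm _ (Complex.exp _)]
    ring
  rw [h5]
  refine (φ.le_opNorm _).trans ?_
  rw [mul_assoc]
  refine mul_le_mul_of_nonneg_left ((norm_add_le _ _).trans ((add_le_add h4 h3).trans ?_))
    (norm_nonneg φ)
  have hB0 : 0 ≤ B := Finset.sum_nonneg fun j _ => norm_nonneg _
  have h6 : 0 ≤ (1 + w.re) * Real.exp ((d - K) * w.re) := by positivity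
  have h7 : 0 ≤ Real.exp ((p - J) * w.re) := by positivity
  nlinarith [mul_le_mul_of_nonneg_right (le_abs_self C) h6, mul_nonneg (abs_nonneg C) h7,
    mul_nonneg hB0 h6]

end

end WeaklyParametric

end

theorem mainTheorem2 {n : ℕ} {A : Type*} [CStarAlgebra A]
    (S : WeaklyParametric.TwistedSystem n A)
    (ψ : A →L[ℂ] ℂ) (hψ : WeaklyParametric.IsInvariantTrace S ψ)
    (Γ : WeaklyParametric.Sector) (m d : ℝ)
    (f : WeaklyParametric.E n → ℂ → A) (F : ℕ → WeaklyParametric.E n → ℂ → A)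
    (hf : WeaklyParametric.IsWeaklyPolyhomogeneous S Γ m d f F)
    (m' d' : ℝ) (hm' : m' < -(n : ℝ))
    (hf' : WeaklyParametric.IsWeakSymbol S Γ m' d' f)
    (hF' : ∀ j : ℕ, -(n : ℝ) ≤ m - j - d → WeaklyParametric.IsWeakSymbol S Γ m' d' (F j)) :
    (∀ μ ∈ Γ.carrier,
      S.HasTraceSymbol (S.multiplier fun ξ => f ξ μ) (fun ξ => f ξ μ) ∧
      MeasureTheory.Integrable (fun ξ => ψ (f ξ μ)) ∧
      S.Tr ψ (S.multiplier fun ξ => f ξ μ) =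
        (((2 * Real.pi : ℝ) ^ n)⁻¹ : ℝ) * ∫ ξ, ψ (f ξ μ)) ∧
    ∃ c c' c'' : ℕ → ℂ,
      WeaklyParametric.HasLogExpansion Γ (m + n) d
        (fun μ => S.Tr ψ (S.multiplier fun ξ => f ξ μ)) c c' c'' := by
  have hsym : ∀ μ ∈ Γ.carrier,
      S.HasTraceSymbol (S.multiplier fun ξ => f ξ μ) (fun ξ => f ξ μ) := fun μ hμ =>
    ⟨⟨m', hm', hf'.isSymbol hμ⟩, rfl⟩
  refine ⟨fun μ hμ => ⟨hsym μ hμ, ?_, ?_⟩, ?_⟩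
  · exact ψ.integrable_comp ((hf'.isSymbol hμ).integrable hm')
  · rw [(hsym μ hμ).tr_eq ψ, ψ.integral_comp_comm ((hf'.isSymbol hμ).integrable hm')]
  · obtain ⟨c, c', c'', h⟩ := hf.exists_integral_expansion hm' hf' hF'
    -- The scalar expansion is the image of the `A`-valued one under `(2π)^{-n} ψ`.
    exact ⟨_, _, _, WeaklyParametric.hasLogExpansion_of_logBound (H := fun μ => ∫ ξ, f ξ μ)
      (((((2 * Real.pi : ℝ) ^ n)⁻¹ : ℝ) : ℂ) • ψ)
      (fun μ hμ => (hsym μ hμ).tr_eq ψ) h⟩
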